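/- Let $k\ge 1$ and let $\Lambda$ be a $k$-graph, i.e. a countable category with object set $\Lambda^0$, codomain and domain maps $r,s$, and a degree functor $d:\Lambda\to\mathbb N^k$ with the factorization property: if $d(\lambda)=m+n$ then there are unique $\mu,\nu$ with $d(\mu)=m$, $d(\nu)=n$ and $\lambda=\mu\nu$. Suppose that $\Lambda$ is row-finite without sources, i.e. $v\Lambda^n:=\{\lambda: r(\lambda)=v,\ d(\lambda)=n\}$ is finite and nonempty for all $v\in\Lambda^0$, $n\in\mathbb N^k$. Let $R$ be a commutative ring with $1\neq 0$. The Kumjian-Pask algebra $\mathrm{KP}_R(\Lambda)$ is the (not necessarily unital) associative $R$-algebra generated by elements $p_v$ ($v\in\Lambda^0$) and $s_\lambda,s_{\lambda^*}$ ($\lambda\in\Lambda$, $d(\lambda)\ne0$) subject to the relations: (KP1) the $p_v$ are mutually orthogonal idempotents; (KP2) if $s(\lambda)=r(\mu)$ then $s_\lambda s_\mu=s_{\lambda\mu}$ and $s_{\mu^*}s_{\lambda^*}=s_{(\lambda\mu)^*}$, and $p_{r(\lambda)}s_\lambda=s_\lambda=s_\lambda p_{s(\lambda)}$, $p_{s(\lambda)}s_{\lambda^*}=s_{\lambda^*}=s_{\lambda^*}p_{r(\lambda)}$;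 (KP3) $s_{\lambda^*}s_\mu=\delta_{\lambda,\mu}p_{s(\lambda)}$ if $d(\lambda)=d(\mu)$; (KP4) $p_v=\sum_{\lambda\in v\Lambda^n}s_\lambda s_{\lambda^*}$ for $n\neq0$. For the path $\lambda$ of degree $0$ at $v$ put $s_\lambda=s_{\lambda^*}=p_v$. The algebra is $\mathbb Z^k$-graded by $\mathrm{KP}_R(\Lambda)_n=\operatorname{span}_R\{s_\lambda s_{\mu^*}: d(\lambda)-d(\mu)=n\}$. A two-sided ideal $I$ is *graded* if the sets $I\cap\mathrm{KP}_R(\Lambda)_n$ form a grading of $I$, and *basic* if $a p_v\in I$ with $v\in\Lambda^0$ and $a\in R\setminus\{0\}$ implies $p_v\in I$. A set $H\subseteq\Lambda^0$ is *hereditary* if $r(\lambda)\in H$ implies $s(\lambda)\in H$ for $\lambda\in\Lambda$, and *saturated* if $s(v\Lambda^n)\subseteq H$ implies $v\in H$ for $v\in\Lambda^0$, $n\in\mathbb N^k$. Let $I_H$ be the ideal generated by $\{p_v: v\in H\}$ and, for an ideal $I$, let $H_I:=\{v\in\Lambda^0:p_v\in I\}$ (a hereditary set). For hereditary $H$, let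 $\Lambda\setminus H$ be the $k$-graph with vertex set $\Lambda^0\setminus H$ and set of paths $\{\lambda\in\Lambda: s(\lambda)\notin H\}$. A $k$-graph $\Lambda$ is *aperiodic* if for all $v\in\Lambda^0$ and $m\neq n$ in $\mathbb N^k$ there is $\lambda\in\Lambda$ with $r(\lambda)=v$, $d(\lambda)\ge m\vee n$ and $\lambda(m,m+d(\lambda)-(m\vee n))\ne\lambda(n,n+d(\lambda)-(m\vee n))$, where $\lambda(p,q)$ for $p\le q\le d(\lambda)$ is the path $\nu$ of degree $q-p$ with $\lambda=\alpha\nu\beta$ and $d(\alpha)=p$. **Theorem.** (a) The map $H\mapsto I_H$ is a lattice isomorphism from the lattice of saturated hereditary subsets of $\Lambda^0$ (ordered by inclusion) onto the set of basic graded ideals of $\mathrm{KP}_R(\Lambda)$ (ordered by inclusion), where the meet and join of two basic graded ideals are their intersection and their sum. (b) Let $I$ be a basic ideal of $\mathrm{KP}_R(\Lambda)$, and suppose that $I$ is graded or that $\Lambda\setminus H_I$ is aperiodic. Write $q_v,t_\lambda,t_{\lambda^*}$ for the generators of $\mathrm{KP}_R(\Lambda\setminus H_I)$. Then there is an isomorphism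 of $R$-algebras $\pi:\mathrm{KP}_R(\Lambda\setminus H_I)\to\mathrm{KP}_R(\Lambda)/I$ such that $\pi(q_v)=p_v+I$, $\pi(t_\lambda)=s_\lambda+I$ and $\pi(t_{\lambda^*})=s_{\lambda^*}+I$ for all vertices $v$ and paths $\lambda$ of $\Lambda\setminus H_I$. -/

import Mathlib

universe u v w

/-! ### Quotients of (not necessarily unital) algebras by two-sided ideals -/

section QuotientAlgebra

variable {R : Type u} {A : Type v} [CommRing R] [NonUnitalRing A] [Module R A]

theorem TwoSidedIdeal.ringCon_smul_of_smul_mem (I : TwoSidedIdeal A)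
    (hI : ∀ (a : R) (x : A), x ∈ I → a • x ∈ I) (a : R) (x y : A)
    (h : I.ringCon x y) : I.ringCon (a • x) (a • y) := by
  rw [I.rel_iff] at h ⊢
  rw [← smul_sub]
  exact hI a _ h

/-- If a two-sided ideal `I` is stable under scalars, then `A/I` is an `R`-module with
`a • (x + I) = a • x + I`. -/
@[reducible] def TwoSidedIdeal.quotientModule (I : TwoSidedIdeal A)
    (hI : ∀ (a : R) (x : A), x ∈ I → a • x ∈ I) : Module R I.ringCon.Quotient :=
  letI : SMul R I.ringCon.Quotient :=
    ⟨fun a => Quotient.map' (a • ·) (fun x y h => I.ringCon_smul_of_smul_mem hI a x y h)⟩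
  Function.Surjective.module R
    (⟨⟨fun x : A => (x : I.ringCon.Quotient), rfl⟩, fun _ _ => rfl⟩ :
      A →+ I.ringCon.Quotient)
    Quotient.mk''_surjective (fun _ _ => rfl)

end QuotientAlgebra

/-! ### Higher-rank graphs -/

/-- A graph of rank `k`: a countable category, given by its objects `Vertex`, its morphisms `Path`,
range (codomain) and source (domain) maps, identities and composition `μ ν` of `μ`, `ν` with
`s μ = r ν`, together with a degree functor to `ℕ^k` satisfying the factorization property. -/
structure KGraph (k : ℕ) where
  Vertex : Type u
  Path : Type v
  countable_path : Countable Path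
  r : Path → Vertex
  s : Path → Vertex
  ident : Vertex → Path
  comp : ∀ μ ν : Path, s μ = r ν → Path
  r_ident : ∀ x, r (ident x) = x
  s_ident : ∀ x, s (ident x) = x
  r_comp : ∀ μ ν h, r (comp μ ν h) = r μ
  s_comp : ∀ μ ν h, s (comp μ ν h) = s ν
  ident_comp : ∀ μ, comp (ident (r μ)) μ (s_ident _) = μ
  comp_ident : ∀ μ, comp μ (ident (s μ)) (r_ident _).symm = μ
  assoc : ∀ μ ν ξ (h₁ : s μ = r ν) (h₂ : s ν = r ξ),
    comp (comp μ ν h₁) ξ ((s_comp μ ν h₁).trans h₂) =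
      comp μ (comp ν ξ h₂) (h₁.trans (r_comp ν ξ h₂).symm)
  /-- the degree functor -/
  d : Path → Fin k → ℕ
  d_ident : ∀ x, d (ident x) = 0
  d_comp : ∀ μ ν h, d (comp μ ν h) = d μ + d ν
  factorization : ∀ (μ : Path) (m n : Fin k → ℕ), d μ = m + n →
    ∃! p : Path × Path, d p.1 = m ∧ d p.2 = n ∧ ∃ h : s p.1 = r p.2, comp p.1 p.2 h = μ

namespace KGraph

variable {k : ℕ} (Λ : KGraph.{u, v} k)

/-- `xΛ^n`: the paths of degree `n` with range `x`. -/
def pathsAt (x : Λ.Vertex) (n : Fin k → ℕ) : Set Λ.Path := {μ | Λ.r μ = x ∧ Λ.d μ = n}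

def RowFinite : Prop := ∀ x n, (Λ.pathsAt x n).Finite

def NoSources : Prop := ∀ x n, (Λ.pathsAt x n).Nonempty

def IsHereditary (H : Set Λ.Vertex) : Prop := ∀ μ : Λ.Path, Λ.r μ ∈ H → Λ.s μ ∈ H

def IsSaturated (H : Set Λ.Vertex) : Prop :=
  ∀ (x : Λ.Vertex) (n : Fin k → ℕ), (∀ μ ∈ Λ.pathsAt x n, Λ.s μ ∈ H) → x ∈ H

/-- `Λ.IsSegment μ p q ν` says that `p ≤ q ≤ d μ` and `ν = μ(p, q)`: there is a factorization
`μ = α (ν β)` with `d α = p`, `d ν = q - p` and `d β = d μ - q`. -/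
def IsSegment (μ : Λ.Path) (p q : Fin k → ℕ) (ν : Λ.Path) : Prop :=
  ∃ (α β : Λ.Path) (h₂ : Λ.s ν = Λ.r β) (h₁ : Λ.s α = Λ.r (Λ.comp ν β h₂)),
    Λ.comp α (Λ.comp ν β h₂) h₁ = μ ∧ Λ.d α = p ∧ p + Λ.d ν = q

/-- Aperiodicity in the finite-path formulation of Robertson and Sims: for all vertices `x` and
`m ≠ n` there is a path `μ` with range `x` and degree at least `m ∨ n` such that
`μ(m, m + d(μ) - (m ∨ n)) ≠ μ(n, n + d(μ) - (m ∨ n))`. -/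
def Aperiodic : Prop :=
  ∀ (x : Λ.Vertex) (m n : Fin k → ℕ), m ≠ n →
    ∃ μ ν ξ : Λ.Path, Λ.r μ = x ∧ m ⊔ n ≤ Λ.d μ ∧
      Λ.IsSegment μ m (m + (Λ.d μ - m ⊔ n)) ν ∧
      Λ.IsSegment μ n (n + (Λ.d μ - m ⊔ n)) ξ ∧ ν ≠ ξ

/-- The saturated hereditary subsets of the vertex set, ordered by inclusion. -/
def SatHer : Type u := {H : Set Λ.Vertex // Λ.IsHereditary H ∧ Λ.IsSaturated H}

instance : PartialOrder Λ.SatHer :=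
  inferInstanceAs (PartialOrder {H : Set Λ.Vertex // Λ.IsHereditary H ∧ Λ.IsSaturated H})

instance : InfSet Λ.SatHer :=
  ⟨fun C => ⟨{x | ∀ H ∈ C, x ∈ H.1},
    fun μ hμ H hH => H.2.1 μ (hμ H hH),
    fun x n hx H hH => H.2.2 x n (fun μ hμ => hx μ hμ H hH)⟩⟩

/-- The lattice of saturated hereditary sets: meets are intersections, and joins are the smallest
saturated hereditary sets containing the union. -/
instance : CompleteLattice Λ.SatHer :=
  completeLatticeOfInf Λ.SatHer (fun _ =>
    ⟨fun _ hH _ hx => hx _ hH, fun _ hK _ hx _ hH => hK hH hx⟩)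

/-- The `k`-graph `Λ ∖ H` for a hereditary set `H`: its vertices are those outside `H`, its paths
are those with source outside `H`, and the structure maps are the restrictions of those of `Λ`. -/
def minus (H : Set Λ.Vertex) (hH : Λ.IsHereditary H) : KGraph.{u, v} k where
  Vertex := {x : Λ.Vertex // x ∉ H}
  Path := {μ : Λ.Path // Λ.s μ ∉ H}
  countable_path := by
    have := Λ.countable_path
    infer_instance
  r μ := ⟨Λ.r μ.1, fun h => μ.2 (hH μ.1 h)⟩
  s μ := ⟨Λ.s μ.1, μ.2⟩
  ident x := ⟨Λ.ident x.1, by rw [Λ.s_ident]; exact x.2⟩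
  comp μ ν h := ⟨Λ.comp μ.1 ν.1 (congrArg Subtype.val h), by rw [Λ.s_comp]; exact ν.2⟩
  r_ident x := Subtype.ext (Λ.r_ident x.1)
  s_ident x := Subtype.ext (Λ.s_ident x.1)
  r_comp _ _ _ := Subtype.ext (Λ.r_comp _ _ _)
  s_comp _ _ _ := Subtype.ext (Λ.s_comp _ _ _)
  ident_comp μ := Subtype.ext (Λ.ident_comp μ.1)
  comp_ident μ := Subtype.ext (Λ.comp_ident μ.1)
  assoc _ _ _ _ _ := Subtype.ext (Λ.assoc _ _ _ _ _)
  d μ := Λ.d μ.1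
  d_ident x := Λ.d_ident x.1
  d_comp _ _ _ := Λ.d_comp _ _ _
  factorization μ m n h := by
    obtain ⟨⟨α, β⟩, ⟨hα, hβ, hc, hμ⟩, huniq⟩ := Λ.factorization μ.1 m n h
    have hsβ : Λ.s β ∉ H := by
      have h1 := μ.2
      rw [← hμ, Λ.s_comp] at h1
      exact h1
    have hsα : Λ.s α ∉ H := fun h1 => hsβ (hH β (hc ▸ h1))
    refine ⟨(⟨α, hsα⟩, ⟨β, hsβ⟩), ⟨hα, hβ, Subtype.ext hc, Subtype.ext hμ⟩, ?_⟩
    rintro ⟨α', β'⟩ ⟨h1, h2, h3, h4⟩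
    have h5 := huniq (α'.1, β'.1)
      ⟨h1, h2, congrArg Subtype.val h3, congrArg Subtype.val h4⟩
    exact Prod.ext (Subtype.ext (congrArg Prod.fst h5)) (Subtype.ext (congrArg Prod.snd h5))

/-! ### The Kumjian-Pask algebra -/

/-- The generators: vertices, paths of nonzero degree, and ghost paths `μ^*` of nonzero degree. -/
inductive Gen (Λ : KGraph.{u, v} k) : Type (max u v)
  | vertex (x : Λ.Vertex) : Gen Λ
  | path (μ : Λ.Path) (h : Λ.d μ ≠ 0) : Gen Λ
  | ghost (μ : Λ.Path) (h : Λ.d μ ≠ 0) : Gen Λ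

variable (R : Type w) [CommRing R]

/-- The free (non-unital, associative) `R`-algebra on the generators: the free `R`-module on
nonempty words, with multiplication extending concatenation. -/
abbrev FreeAlg : Type (max u v w) := MonoidAlgebra R (FreeSemigroup Λ.Gen)

/-- A generator as an element of the free algebra. -/
noncomputable def gen (g : Λ.Gen) : Λ.FreeAlg R := MonoidAlgebra.single (FreeSemigroup.of g) 1

open Gen in
/-- The Kumjian-Pask relations, as elements of the free algebra which are to become zero. -/
inductive Rel (Λ : KGraph.{u, v} k) (R : Type w) [CommRing R] : Λ.FreeAlg R → Prop
  -- (KP1)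
  | idem (x : Λ.Vertex) :
      Rel Λ R (Λ.gen R (vertex x) * Λ.gen R (vertex x) - Λ.gen R (vertex x))
  | orthogonal (x y : Λ.Vertex) (hxy : x ≠ y) :
      Rel Λ R (Λ.gen R (vertex x) * Λ.gen R (vertex y))
  -- (KP2)
  | path_mul (μ ν : Λ.Path) (hμ : Λ.d μ ≠ 0) (hν : Λ.d ν ≠ 0) (h : Λ.s μ = Λ.r ν)
      (hμν : Λ.d (Λ.comp μ ν h) ≠ 0) :
      Rel Λ R (Λ.gen R (path μ hμ) * Λ.gen R (path ν hν) - Λ.gen R (path (Λ.comp μ ν h) hμν))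
  | ghost_mul (μ ν : Λ.Path) (hμ : Λ.d μ ≠ 0) (hν : Λ.d ν ≠ 0) (h : Λ.s μ = Λ.r ν)
      (hμν : Λ.d (Λ.comp μ ν h) ≠ 0) :
      Rel Λ R (Λ.gen R (ghost ν hν) * Λ.gen R (ghost μ hμ) - Λ.gen R (ghost (Λ.comp μ ν h) hμν))
  | range_path (μ : Λ.Path) (hμ : Λ.d μ ≠ 0) :
      Rel Λ R (Λ.gen R (vertex (Λ.r μ)) * Λ.gen R (path μ hμ) - Λ.gen R (path μ hμ))
  | path_source (μ : Λ.Path) (hμ : Λ.d μ ≠ 0) :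
      Rel Λ R (Λ.gen R (path μ hμ) * Λ.gen R (vertex (Λ.s μ)) - Λ.gen R (path μ hμ))
  | source_ghost (μ : Λ.Path) (hμ : Λ.d μ ≠ 0) :
      Rel Λ R (Λ.gen R (vertex (Λ.s μ)) * Λ.gen R (ghost μ hμ) - Λ.gen R (ghost μ hμ))
  | ghost_range (μ : Λ.Path) (hμ : Λ.d μ ≠ 0) :
      Rel Λ R (Λ.gen R (ghost μ hμ) * Λ.gen R (vertex (Λ.r μ)) - Λ.gen R (ghost μ hμ))
  -- (KP3)
  | ghost_path_self (μ : Λ.Path) (hμ : Λ.d μ ≠ 0) :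
      Rel Λ R (Λ.gen R (ghost μ hμ) * Λ.gen R (path μ hμ) - Λ.gen R (vertex (Λ.s μ)))
  | ghost_path_of_ne (μ ν : Λ.Path) (hμ : Λ.d μ ≠ 0) (hν : Λ.d ν ≠ 0) (hd : Λ.d μ = Λ.d ν)
      (hμν : μ ≠ ν) :
      Rel Λ R (Λ.gen R (ghost μ hμ) * Λ.gen R (path ν hν))
  -- (KP4)
  | sum_path_ghost (x : Λ.Vertex) (n : Fin k → ℕ) (hn : n ≠ 0) (hfin : (Λ.pathsAt x n).Finite) :
      Rel Λ R (Λ.gen R (vertex x) - ∑ μ ∈ hfin.toFinset.attach,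
        Λ.gen R (path μ.1 (((hfin.mem_toFinset.1 μ.2).2).trans_ne hn)) *
          Λ.gen R (ghost μ.1 (((hfin.mem_toFinset.1 μ.2).2).trans_ne hn)))

/-- The `R`-algebra ideal of the free algebra generated by the Kumjian-Pask relations. (The free
algebra has no identity, so scalar multiples of the relations are thrown in.) -/
noncomputable def relIdeal : TwoSidedIdeal (Λ.FreeAlg R) :=
  TwoSidedIdeal.span {x | ∃ (a : R) (y : Λ.FreeAlg R), Rel Λ R y ∧ x = a • y}

theorem smul_mem_relIdeal (a : R) (x : Λ.FreeAlg R) (hx : x ∈ Λ.relIdeal R) :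
    a • x ∈ Λ.relIdeal R := by
  induction hx using TwoSidedIdeal.span_induction with
  | mem x h =>
    obtain ⟨b, y, hy, rfl⟩ := h
    exact TwoSidedIdeal.subset_span ⟨a * b, y, hy, smul_smul a b y⟩
  | zero => rw [smul_zero]; exact TwoSidedIdeal.zero_mem _
  | add x y _ _ hx hy => rw [smul_add]; exact TwoSidedIdeal.add_mem _ hx hy
  | neg x _ hx => rw [smul_neg]; exact TwoSidedIdeal.neg_mem _ hx
  | left_absorb b x _ hx => rw [← mul_smul_comm]; exact TwoSidedIdeal.mul_mem_left _ _ _ hx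
  | right_absorb b x _ hx => rw [← smul_mul_assoc]; exact TwoSidedIdeal.mul_mem_right _ _ _ hx

/-- The Kumjian-Pask algebra `KP_R(Λ)`: the (in general non-unital) `R`-algebra generated by the
vertices, paths and ghost paths subject to the Kumjian-Pask relations. -/
def KP : Type (max u v w) := (Λ.relIdeal R).ringCon.Quotient

noncomputable instance : NonUnitalRing (Λ.KP R) :=
  inferInstanceAs (NonUnitalRing (Λ.relIdeal R).ringCon.Quotient)

noncomputable instance : Module R (Λ.KP R) :=
  (Λ.relIdeal R).quotientModule (Λ.smul_mem_relIdeal R)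

/-- The quotient map from the free algebra. -/
noncomputable def toKP (x : Λ.FreeAlg R) : Λ.KP R := (x : (Λ.relIdeal R).ringCon.Quotient)

theorem toKP_surjective : Function.Surjective (Λ.toKP R) := Quotient.mk''_surjective

instance : IsScalarTower R (Λ.KP R) (Λ.KP R) where
  smul_assoc a x y := by
    obtain ⟨x, rfl⟩ := Λ.toKP_surjective R x
    obtain ⟨y, rfl⟩ := Λ.toKP_surjective R y
    exact congrArg (Λ.toKP R) (smul_mul_assoc a x y)

instance : SMulCommClass R (Λ.KP R) (Λ.KP R) where
  smul_comm a x y := by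
    obtain ⟨x, rfl⟩ := Λ.toKP_surjective R x
    obtain ⟨y, rfl⟩ := Λ.toKP_surjective R y
    exact congrArg (Λ.toKP R) (mul_smul_comm a x y).symm

/-- The vertex idempotent `p_x`. -/
noncomputable def p (x : Λ.Vertex) : Λ.KP R := Λ.toKP R (Λ.gen R (Gen.vertex x))

/-- The element `s_μ`, with the convention `s_μ = p_x` if `μ` is the path of degree `0` at `x`. -/
noncomputable def sPath (μ : Λ.Path) : Λ.KP R :=
  if h : Λ.d μ = 0 then Λ.p R (Λ.r μ) else Λ.toKP R (Λ.gen R (Gen.path μ h))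

/-- The element `s_{μ^*}`, with the convention `s_{μ^*} = p_x` if `μ` is the path of degree `0`
at `x`. -/
noncomputable def sGhost (μ : Λ.Path) : Λ.KP R :=
  if h : Λ.d μ = 0 then Λ.p R (Λ.r μ) else Λ.toKP R (Λ.gen R (Gen.ghost μ h))

/-- The homogeneous component `KP_R(Λ)_n = span_R {s_μ s_{ν^*} : d(μ) - d(ν) = n}`. -/
noncomputable def component (n : Fin k → ℤ) : Submodule R (Λ.KP R) :=
  Submodule.span R {x | ∃ μ ν : Λ.Path,
    (∀ i, (Λ.d μ i : ℤ) - (Λ.d ν i : ℤ) = n i) ∧ x = Λ.sPath R μ * Λ.sGhost R ν}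

variable {Λ R}

/-- An ideal `I` is graded if the `I ∩ KP_R(Λ)_n` form a grading of `I`: every element of `I` has
exactly one decomposition as a finite sum of elements of the `I ∩ KP_R(Λ)_n`. (Products of elements
of degrees `m` and `n` have degree `m + n` already in `KP_R(Λ)`.) -/
def IsGraded (I : TwoSidedIdeal (Λ.KP R)) : Prop :=
  ∀ x ∈ I, ∃! f : (Fin k → ℤ) →₀ Λ.KP R,
    (∀ n, f n ∈ I ∧ f n ∈ Λ.component R n) ∧ (f.sum fun _ y => y) = x

/-- An ideal `I` is basic if `a p_x ∈ I` and `a ≠ 0` imply `p_x ∈ I`. -/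
def IsBasic (I : TwoSidedIdeal (Λ.KP R)) : Prop :=
  ∀ (a : R) (x : Λ.Vertex), a ≠ 0 → a • Λ.p R x ∈ I → Λ.p R x ∈ I

variable (R) in
/-- `I_H`: the ideal generated by the `p_x` with `x ∈ H`. -/
noncomputable def idealOf (H : Set Λ.Vertex) : TwoSidedIdeal (Λ.KP R) :=
  TwoSidedIdeal.span (Λ.p R '' H)

/-- `H_I`: the set of vertices `x` with `p_x ∈ I`. -/
def vertexSet (I : TwoSidedIdeal (Λ.KP R)) : Set Λ.Vertex := {x | Λ.p R x ∈ I}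

theorem toKP_eq_zero_of_rel {x : Λ.FreeAlg R} (h : Rel Λ R x) : Λ.toKP R x = 0 := by
  have h1 : x ∈ Λ.relIdeal R := TwoSidedIdeal.subset_span ⟨1, x, h, (one_smul R x).symm⟩
  exact Quotient.sound' ((TwoSidedIdeal.mem_iff _ _).1 h1)

theorem toKP_sub (x y : Λ.FreeAlg R) : Λ.toKP R (x - y) = Λ.toKP R x - Λ.toKP R y := rfl

theorem toKP_mul (x y : Λ.FreeAlg R) : Λ.toKP R (x * y) = Λ.toKP R x * Λ.toKP R y := rfl

theorem toKP_add (x y : Λ.FreeAlg R) : Λ.toKP R (x + y) = Λ.toKP R x + Λ.toKP R y := rfl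

theorem toKP_smul (a : R) (x : Λ.FreeAlg R) : Λ.toKP R (a • x) = a • Λ.toKP R x := rfl

theorem toKP_eq_of_rel {x y : Λ.FreeAlg R} (h : Rel Λ R (x - y)) : Λ.toKP R x = Λ.toKP R y :=
  sub_eq_zero.1 (toKP_eq_zero_of_rel h)

theorem ident_eq_of_d_eq_zero (μ : Λ.Path) (h : Λ.d μ = 0) : μ = Λ.ident (Λ.r μ) := by
  have h0 : Λ.d μ = 0 + 0 := by rw [h, add_zero]
  obtain ⟨q, -, hq⟩ := Λ.factorization μ 0 0 h0
  have h1 := hq (Λ.ident (Λ.r μ), μ) ⟨Λ.d_ident _, h, Λ.s_ident _, Λ.ident_comp μ⟩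
  have h2 := hq (μ, Λ.ident (Λ.s μ)) ⟨h, Λ.d_ident _, (Λ.r_ident _).symm, Λ.comp_ident μ⟩
  exact congrArg Prod.fst (h2.trans h1.symm)

theorem isHereditary_vertexSet (I : TwoSidedIdeal (Λ.KP R)) :
    Λ.IsHereditary (vertexSet I) := by
  intro μ hμ
  by_cases h : Λ.d μ = 0
  · have h1 : Λ.s μ = Λ.r μ := by
      conv_lhs => rw [ident_eq_of_d_eq_zero μ h, Λ.s_ident]
    rw [h1]
    exact hμ
  · have h1 : Λ.p R (Λ.s μ) = Λ.toKP R (Λ.gen R (Gen.ghost μ h)) *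
        (Λ.p R (Λ.r μ) * Λ.toKP R (Λ.gen R (Gen.path μ h))) := by
      have h2 := toKP_eq_of_rel (Rel.range_path (R := R) μ h)
      have h3 := toKP_eq_of_rel (Rel.ghost_path_self (R := R) μ h)
      rw [toKP_mul] at h2 h3
      rw [p, p, h2, h3]
    change Λ.p R (Λ.s μ) ∈ I
    rw [h1]
    exact TwoSidedIdeal.mul_mem_left _ _ _ (TwoSidedIdeal.mul_mem_right _ _ _ hμ)

/-- `Λ ∖ H_I`. -/
def quotientGraph (I : TwoSidedIdeal (Λ.KP R)) : KGraph.{u, v} k :=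
  Λ.minus (vertexSet I) (isHereditary_vertexSet I)

/-! ### The quotient algebra `KP_R(Λ)/I` -/

theorem exists_vertex_mul_gen (g : Λ.Gen) :
    ∃ x : Λ.Vertex, Λ.p R x * Λ.toKP R (Λ.gen R g) = Λ.toKP R (Λ.gen R g) := by
  cases g with
  | vertex x => exact ⟨x, toKP_eq_of_rel (Rel.idem x)⟩
  | path μ h => exact ⟨Λ.r μ, toKP_eq_of_rel (Rel.range_path μ h)⟩
  | ghost μ h => exact ⟨Λ.s μ, toKP_eq_of_rel (Rel.source_ghost μ h)⟩

theorem sum_p_mul_p (F : Finset Λ.Vertex) (x : Λ.Vertex) (hx : x ∈ F) :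
    (∑ y ∈ F, Λ.p R y) * Λ.p R x = Λ.p R x := by
  rw [Finset.sum_mul, Finset.sum_eq_single x]
  · exact toKP_eq_of_rel (Rel.idem x)
  · intro y _ hyx
    exact toKP_eq_zero_of_rel (Rel.orthogonal y x hyx)
  · exact fun h => absurd hx h

theorem sum_p_mul_gen_mul (g : Λ.Gen) : ∃ x : Λ.Vertex, ∀ F : Finset Λ.Vertex, x ∈ F →
    ∀ z : Λ.KP R, (∑ y ∈ F, Λ.p R y) * (Λ.toKP R (Λ.gen R g) * z) =
      Λ.toKP R (Λ.gen R g) * z := by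
  obtain ⟨x, hx⟩ := exists_vertex_mul_gen (R := R) g
  refine ⟨x, fun F hF z => ?_⟩
  rw [← mul_assoc]
  congr 1
  rw [← hx, ← mul_assoc, sum_p_mul_p F x hF]

/-- `KP_R(Λ)` has local units. -/
theorem exists_local_unit (z : Λ.KP R) : ∃ e : Λ.KP R, e * z = z := by
  classical
  suffices h : ∃ F₀ : Finset Λ.Vertex, ∀ F, F₀ ⊆ F → (∑ y ∈ F, Λ.p R y) * z = z by
    obtain ⟨F, hF⟩ := h
    exact ⟨_, hF F subset_rfl⟩
  obtain ⟨z, rfl⟩ := Λ.toKP_surjective R z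
  induction z using MonoidAlgebra.induction_linear with
  | zero => exact ⟨∅, fun F _ => mul_zero _⟩
  | add x y hx hy =>
    obtain ⟨F, hF⟩ := hx
    obtain ⟨G, hG⟩ := hy
    refine ⟨F ∪ G, fun K hK => ?_⟩
    rw [toKP_add, mul_add, hF K (Finset.union_subset_left hK),
      hG K (Finset.union_subset_right hK)]
  | single w a =>
    induction w using FreeSemigroup.recOnMul with
    | ih1 g =>
      obtain ⟨x, hx⟩ := exists_vertex_mul_gen (R := R) g
      refine ⟨{x}, fun F hF => ?_⟩
      have h1 : (MonoidAlgebra.single (FreeSemigroup.of g) a : Λ.FreeAlg R) =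
          a • Λ.gen R g := by
        rw [gen, MonoidAlgebra.smul_single, smul_eq_mul, mul_one]
      rw [h1, toKP_smul, mul_smul_comm]
      congr 1
      rw [← hx, ← mul_assoc, sum_p_mul_p F x (hF (Finset.mem_singleton_self x))]
    | ih2 g w _ _ =>
      obtain ⟨x, hx⟩ := sum_p_mul_gen_mul (R := R) g
      refine ⟨{x}, fun F hF => ?_⟩
      have h1 : (MonoidAlgebra.single (FreeSemigroup.of g * w) a : Λ.FreeAlg R) =
          Λ.gen R g * MonoidAlgebra.single w a := by
        rw [gen, MonoidAlgebra.single_mul_single, one_mul]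
      rw [h1, toKP_mul, hx F (hF (Finset.mem_singleton_self x))]

theorem smul_mem_ideal (I : TwoSidedIdeal (Λ.KP R)) (a : R) (z : Λ.KP R) (hz : z ∈ I) :
    a • z ∈ I := by
  obtain ⟨e, he⟩ := exists_local_unit z
  rw [← he, ← smul_mul_assoc]
  exact TwoSidedIdeal.mul_mem_left _ _ _ hz

/-- The quotient `KP_R(Λ)/I`. -/
def QuotKP (I : TwoSidedIdeal (Λ.KP R)) : Type (max u v w) := I.ringCon.Quotient

noncomputable instance (I : TwoSidedIdeal (Λ.KP R)) : NonUnitalRing (QuotKP I) :=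
  inferInstanceAs (NonUnitalRing I.ringCon.Quotient)

/-- The `R`-module structure `a • (z + I) = a • z + I` of `KP_R(Λ)/I`. -/
noncomputable instance (I : TwoSidedIdeal (Λ.KP R)) : Module R (QuotKP I) :=
  I.quotientModule (smul_mem_ideal I)

/-- The quotient map `z ↦ z + I`. -/
noncomputable def toQuot (I : TwoSidedIdeal (Λ.KP R)) (z : Λ.KP R) : QuotKP I := (z : I.ringCon.Quotient)

end KGraph

/-! Three mechanisms carry the theorem.

Normal forms. Since (KP4) writes `p_{s(μ)}` as a sum over paths of any given degree, a homogeneous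
element is a combination of elements `s_μ s_{ν^*}` with all `μ` of one degree `M` and all `ν` of one
degree `N`. By (KP3) such elements behave like matrix units: `s_{μ^*} x s_ν = c_{μν} p_{s(μ)}` for
the coefficients `c` of `x`. Hence, if `x` lies in a basic ideal, so does `p_{s(μ)}` whenever
`c_{μν} ≠ 0`, and a basic graded ideal is generated by its vertex idempotents (`idealOf_vertexSet`).
The components of the grading are independent because the relations are homogeneous, so that the
degree projections of the free algebra descend to `KP_R(Λ)`.

A representation. To see that `I_H` contains no `a p_x` with `a ≠ 0` and `x ∉ H`, let `KP_R(Λ)` act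
on functions on the finite paths, modulo functions vanishing on all paths of large degree with
source outside `H`. Heredity makes `I_H` act as zero. If `a p_x` kills the constant function `1`,
all paths of some degree with range `x` end in `H`, and saturation gives `x ∈ H`
(`mem_of_smul_p_mem_idealOf`). So `I_H` is basic and `H_{I_H} = H`, which with the first point gives
(a).

Uniqueness theorems. The generators of `KP_R(Λ ∖ H_I)` map onto those of `KP_R(Λ)/I` that survive.
If the kernel were nonzero, it would contain some `a p_x` with `a ≠ 0`: compress a homogeneous
component if `I`, and with it the kernel, is graded; in the aperiodic case compress an arbitrary
element, then remove its parts of nonzero degree by further compressions. As `I` is basic, this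
would put `x` into `H_I`, although `x` is a vertex of `Λ ∖ H_I`. -/

namespace KGraph

/-! ### Consequences of the Kumjian-Pask relations -/

section Relations

variable {k : ℕ} {Λ : KGraph.{u, v} k} {R : Type w} [CommRing R]

theorem comp_inj {μ ν μ' ν' : Λ.Path} {h : Λ.s μ = Λ.r ν} {h' : Λ.s μ' = Λ.r ν'}
    (hd : Λ.d μ = Λ.d μ') (he : Λ.comp μ ν h = Λ.comp μ' ν' h') : μ = μ' ∧ ν = ν' := by
  have hdν : Λ.d ν' = Λ.d ν := by
    have h1 := congrArg Λ.d he
    rw [Λ.d_comp, Λ.d_comp, hd] at h1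
    exact (add_left_cancel h1).symm
  obtain ⟨q, -, hq⟩ := Λ.factorization _ _ _ (Λ.d_comp μ ν h)
  have h1 := hq (μ, ν) ⟨rfl, rfl, h, rfl⟩
  have h2 := hq (μ', ν') ⟨hd.symm, hdν, h', he.symm⟩
  exact Prod.mk.inj (h1.trans h2.symm)

theorem exists_comp_eq {μ : Λ.Path} {n : Fin k → ℕ} (hn : n ≤ Λ.d μ) :
    ∃ (α β : Λ.Path) (h : Λ.s α = Λ.r β), Λ.d α = n ∧ Λ.comp α β h = μ := by
  obtain ⟨⟨α, β⟩, ⟨h1, -, h, h2⟩, -⟩ :=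
    Λ.factorization μ n (Λ.d μ - n) (add_tsub_cancel_of_le hn).symm
  exact ⟨α, β, h, h1, h2⟩

theorem s_eq_r_of_d_eq_zero {μ : Λ.Path} (h : Λ.d μ = 0) : Λ.s μ = Λ.r μ := by
  conv_lhs => rw [ident_eq_of_d_eq_zero μ h, Λ.s_ident]

theorem comp_eq_right_of_d_eq_zero {μ ν : Λ.Path} (h : Λ.s μ = Λ.r ν) (hμ : Λ.d μ = 0) :
    Λ.comp μ ν h = ν := by
  have h1 : μ = Λ.ident (Λ.r ν) := by
    rw [← h, s_eq_r_of_d_eq_zero hμ]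
    exact ident_eq_of_d_eq_zero μ hμ
  subst h1
  exact Λ.ident_comp ν

theorem comp_eq_left_of_d_eq_zero {μ ν : Λ.Path} (h : Λ.s μ = Λ.r ν) (hν : Λ.d ν = 0) :
    Λ.comp μ ν h = μ := by
  have h1 : ν = Λ.ident (Λ.s μ) := by
    rw [h]
    exact ident_eq_of_d_eq_zero ν hν
  subst h1
  exact Λ.comp_ident μ

theorem p_mul_p_self (x : Λ.Vertex) : Λ.p R x * Λ.p R x = Λ.p R x :=
  toKP_eq_of_rel (Rel.idem x)

theorem p_mul_p_of_ne {x y : Λ.Vertex} (h : x ≠ y) : Λ.p R x * Λ.p R y = 0 :=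
  toKP_eq_zero_of_rel (Rel.orthogonal x y h)

theorem sPath_of_d_eq_zero {μ : Λ.Path} (h : Λ.d μ = 0) : Λ.sPath R μ = Λ.p R (Λ.r μ) :=
  dif_pos h

theorem sPath_of_d_ne_zero {μ : Λ.Path} (h : Λ.d μ ≠ 0) :
    Λ.sPath R μ = Λ.toKP R (Λ.gen R (Gen.path μ h)) := dif_neg h

theorem sGhost_of_d_eq_zero {μ : Λ.Path} (h : Λ.d μ = 0) : Λ.sGhost R μ = Λ.p R (Λ.r μ) :=
  dif_pos h

theorem sGhost_of_d_ne_zero {μ : Λ.Path} (h : Λ.d μ ≠ 0) :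
    Λ.sGhost R μ = Λ.toKP R (Λ.gen R (Gen.ghost μ h)) := dif_neg h

theorem sPath_ident (x : Λ.Vertex) : Λ.sPath R (Λ.ident x) = Λ.p R x := by
  rw [sPath_of_d_eq_zero (Λ.d_ident x), Λ.r_ident]

theorem sGhost_ident (x : Λ.Vertex) : Λ.sGhost R (Λ.ident x) = Λ.p R x := by
  rw [sGhost_of_d_eq_zero (Λ.d_ident x), Λ.r_ident]

theorem p_mul_sPath (μ : Λ.Path) : Λ.p R (Λ.r μ) * Λ.sPath R μ = Λ.sPath R μ := by
  by_cases h : Λ.d μ = 0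
  · rw [sPath_of_d_eq_zero h, p_mul_p_self]
  · rw [sPath_of_d_ne_zero h]
    exact toKP_eq_of_rel (Rel.range_path μ h)

theorem sPath_mul_p (μ : Λ.Path) : Λ.sPath R μ * Λ.p R (Λ.s μ) = Λ.sPath R μ := by
  by_cases h : Λ.d μ = 0
  · rw [sPath_of_d_eq_zero h, s_eq_r_of_d_eq_zero h, p_mul_p_self]
  · rw [sPath_of_d_ne_zero h]
    exact toKP_eq_of_rel (Rel.path_source μ h)

theorem p_mul_sGhost (μ : Λ.Path) : Λ.p R (Λ.s μ) * Λ.sGhost R μ = Λ.sGhost R μ := by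
  by_cases h : Λ.d μ = 0
  · rw [sGhost_of_d_eq_zero h, s_eq_r_of_d_eq_zero h, p_mul_p_self]
  · rw [sGhost_of_d_ne_zero h]
    exact toKP_eq_of_rel (Rel.source_ghost μ h)

theorem sGhost_mul_p (μ : Λ.Path) : Λ.sGhost R μ * Λ.p R (Λ.r μ) = Λ.sGhost R μ := by
  by_cases h : Λ.d μ = 0
  · rw [sGhost_of_d_eq_zero h, p_mul_p_self]
  · rw [sGhost_of_d_ne_zero h]
    exact toKP_eq_of_rel (Rel.ghost_range μ h)

theorem d_comp_ne_zero {μ ν : Λ.Path} (h : Λ.s μ = Λ.r ν) (hμ : Λ.d μ ≠ 0) :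
    Λ.d (Λ.comp μ ν h) ≠ 0 := by
  rw [Λ.d_comp]
  exact fun h0 => hμ (add_eq_zero.1 h0).1

theorem sPath_mul_sPath {μ ν : Λ.Path} (h : Λ.s μ = Λ.r ν) :
    Λ.sPath R μ * Λ.sPath R ν = Λ.sPath R (Λ.comp μ ν h) := by
  by_cases hμ : Λ.d μ = 0
  · rw [comp_eq_right_of_d_eq_zero h hμ, sPath_of_d_eq_zero hμ, ← s_eq_r_of_d_eq_zero hμ, h,
      p_mul_sPath]
  by_cases hν : Λ.d ν = 0
  · rw [comp_eq_left_of_d_eq_zero h hν, sPath_of_d_eq_zero hν, ← h, sPath_mul_p]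
  rw [sPath_of_d_ne_zero hμ, sPath_of_d_ne_zero hν, sPath_of_d_ne_zero (d_comp_ne_zero h hμ)]
  exact toKP_eq_of_rel (Rel.path_mul μ ν hμ hν h _)

theorem sGhost_mul_sGhost {μ ν : Λ.Path} (h : Λ.s μ = Λ.r ν) :
    Λ.sGhost R ν * Λ.sGhost R μ = Λ.sGhost R (Λ.comp μ ν h) := by
  by_cases hμ : Λ.d μ = 0
  · rw [comp_eq_right_of_d_eq_zero h hμ, sGhost_of_d_eq_zero hμ, ← s_eq_r_of_d_eq_zero hμ, h,
      sGhost_mul_p]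
  by_cases hν : Λ.d ν = 0
  · rw [comp_eq_left_of_d_eq_zero h hν, sGhost_of_d_eq_zero hν, ← h, p_mul_sGhost]
  rw [sGhost_of_d_ne_zero hμ, sGhost_of_d_ne_zero hν, sGhost_of_d_ne_zero (d_comp_ne_zero h hμ)]
  exact toKP_eq_of_rel (Rel.ghost_mul μ ν hμ hν h _)

theorem sPath_mul_sPath_of_ne {μ ν : Λ.Path} (h : Λ.s μ ≠ Λ.r ν) :
    Λ.sPath R μ * Λ.sPath R ν = 0 := by
  rw [← sPath_mul_p μ, ← p_mul_sPath ν, mul_assoc, ← mul_assoc (Λ.p R _), p_mul_p_of_ne h,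
    zero_mul, mul_zero]

theorem sGhost_mul_sGhost_of_ne {μ ν : Λ.Path} (h : Λ.s μ ≠ Λ.r ν) :
    Λ.sGhost R ν * Λ.sGhost R μ = 0 := by
  rw [← sGhost_mul_p ν, ← p_mul_sGhost μ, mul_assoc, ← mul_assoc (Λ.p R _),
    p_mul_p_of_ne (Ne.symm h), zero_mul, mul_zero]

theorem sGhost_mul_sPath_of_r_ne {μ ν : Λ.Path} (h : Λ.r ν ≠ Λ.r μ) :
    Λ.sGhost R ν * Λ.sPath R μ = 0 := by
  rw [← sGhost_mul_p ν, ← p_mul_sPath μ, mul_assoc, ← mul_assoc (Λ.p R _),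
    p_mul_p_of_ne h, zero_mul, mul_zero]

theorem sPath_mul_sGhost_of_s_ne {μ ν : Λ.Path} (h : Λ.s μ ≠ Λ.s ν) :
    Λ.sPath R μ * Λ.sGhost R ν = 0 := by
  rw [← sPath_mul_p μ, ← p_mul_sGhost ν, mul_assoc, ← mul_assoc (Λ.p R _),
    p_mul_p_of_ne h, zero_mul, mul_zero]

theorem sGhost_mul_sPath_self (μ : Λ.Path) :
    Λ.sGhost R μ * Λ.sPath R μ = Λ.p R (Λ.s μ) := by
  by_cases h : Λ.d μ = 0
  · rw [sGhost_of_d_eq_zero h, sPath_of_d_eq_zero h, s_eq_r_of_d_eq_zero h, p_mul_p_self]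
  · rw [sGhost_of_d_ne_zero h, sPath_of_d_ne_zero h]
    exact toKP_eq_of_rel (Rel.ghost_path_self μ h)

theorem sGhost_mul_sPath_of_ne {μ ν : Λ.Path} (hd : Λ.d μ = Λ.d ν) (h : μ ≠ ν) :
    Λ.sGhost R μ * Λ.sPath R ν = 0 := by
  by_cases hμ : Λ.d μ = 0
  · refine sGhost_mul_sPath_of_r_ne fun hr => h ?_
    rw [ident_eq_of_d_eq_zero μ hμ, ident_eq_of_d_eq_zero ν (hd ▸ hμ), hr]
  · have hν : Λ.d ν ≠ 0 := hd ▸ hμ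
    rw [sGhost_of_d_ne_zero hμ, sPath_of_d_ne_zero hν]
    exact toKP_eq_zero_of_rel (Rel.ghost_path_of_ne μ ν hμ hν hd h)

theorem toKP_sum {ι : Type*} (F : Finset ι) (f : ι → Λ.FreeAlg R) :
    Λ.toKP R (∑ i ∈ F, f i) = ∑ i ∈ F, Λ.toKP R (f i) :=
  map_sum (⟨⟨Λ.toKP R, rfl⟩, toKP_add⟩ : Λ.FreeAlg R →+ Λ.KP R) f F

/-- (KP4) without the restriction `n ≠ 0`: for `n = 0` the only term is `p_x p_x`. -/
theorem p_eq_sum (hfin : Λ.RowFinite) (x : Λ.Vertex) (n : Fin k → ℕ) :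
    Λ.p R x = ∑ μ ∈ (hfin x n).toFinset, Λ.sPath R μ * Λ.sGhost R μ := by
  by_cases hn : n = 0
  · have h1 : (hfin x n).toFinset = {Λ.ident x} := by
      ext μ
      rw [Set.Finite.mem_toFinset, Finset.mem_singleton, hn]
      constructor
      · rintro ⟨h1, h2⟩
        rw [ident_eq_of_d_eq_zero μ h2, h1]
      · rintro rfl
        exact ⟨Λ.r_ident x, Λ.d_ident x⟩
    rw [h1, Finset.sum_singleton, sPath_ident, sGhost_ident, p_mul_p_self]
  · rw [← Finset.sum_attach]
    refine (toKP_eq_of_rel (Rel.sum_path_ghost x n hn (hfin x n))).trans ?_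
    rw [toKP_sum]
    refine Finset.sum_congr rfl fun μ _ => ?_
    have h0 : Λ.d μ.1 ≠ 0 := (((hfin x n).mem_toFinset.1 μ.2).2).trans_ne hn
    rw [toKP_mul, sPath_of_d_ne_zero h0, sGhost_of_d_ne_zero h0]

/-- `s_{ν^*} s_μ` for `d ν ≤ d μ`. -/
theorem sGhost_mul_sPath_of_le {μ ν : Λ.Path} (hd : Λ.d ν ≤ Λ.d μ) :
    Λ.sGhost R ν * Λ.sPath R μ = 0 ∨
      ∃ (β : Λ.Path) (h : Λ.s ν = Λ.r β), Λ.comp ν β h = μ ∧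
        Λ.sGhost R ν * Λ.sPath R μ = Λ.sPath R β := by
  obtain ⟨α, β, h, hα, rfl⟩ := exists_comp_eq hd
  by_cases hν : ν = α
  · subst hν
    refine Or.inr ⟨β, h, rfl, ?_⟩
    rw [← sPath_mul_sPath h, ← mul_assoc, sGhost_mul_sPath_self, h, p_mul_sPath]
  · left
    rw [← sPath_mul_sPath h, ← mul_assoc, sGhost_mul_sPath_of_ne hα.symm hν, zero_mul]

/-- `s_{μ^*} s_ν` for `d ν ≤ d μ`. -/
theorem sGhost_mul_sPath_of_ge {μ ν : Λ.Path} (hd : Λ.d ν ≤ Λ.d μ) :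
    Λ.sGhost R μ * Λ.sPath R ν = 0 ∨
      ∃ (β : Λ.Path) (h : Λ.s ν = Λ.r β), Λ.comp ν β h = μ ∧
        Λ.sGhost R μ * Λ.sPath R ν = Λ.sGhost R β := by
  obtain ⟨α, β, h, hα, rfl⟩ := exists_comp_eq hd
  by_cases hν : ν = α
  · subst hν
    refine Or.inr ⟨β, h, rfl, ?_⟩
    rw [← sGhost_mul_sGhost h, mul_assoc, sGhost_mul_sPath_self, h, sGhost_mul_p]
  · left
    rw [← sGhost_mul_sGhost h, mul_assoc, sGhost_mul_sPath_of_ne hα (Ne.symm hν), mul_zero]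

/-! ### Homogeneous components -/

/-- The difference of the degrees of two paths. -/
def degDiff (μ ν : Λ.Path) : Fin k → ℤ := fun i => (Λ.d μ i : ℤ) - (Λ.d ν i : ℤ)

theorem sPath_mem_component (μ : Λ.Path) :
    Λ.sPath R μ ∈ Λ.component R (fun i => (Λ.d μ i : ℤ)) := by
  refine Submodule.subset_span ⟨μ, Λ.ident (Λ.s μ), fun i => ?_, ?_⟩
  · rw [Λ.d_ident, Pi.zero_apply, Nat.cast_zero, sub_zero]
  · rw [sGhost_ident, sPath_mul_p]

theorem sGhost_mem_component (μ : Λ.Path) :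
    Λ.sGhost R μ ∈ Λ.component R (fun i => -(Λ.d μ i : ℤ)) := by
  refine Submodule.subset_span ⟨Λ.ident (Λ.s μ), μ, fun i => ?_, ?_⟩
  · rw [Λ.d_ident, Pi.zero_apply, Nat.cast_zero, zero_sub]
  · rw [sPath_ident, p_mul_sGhost]

theorem p_mem_component (x : Λ.Vertex) : Λ.p R x ∈ Λ.component R 0 := by
  refine Submodule.subset_span ⟨Λ.ident x, Λ.ident x, fun i => sub_self _, ?_⟩
  rw [sPath_ident, sGhost_ident, p_mul_p_self]

/-- Inserting (KP4) at the degree `d μ ⊔ d ν` between the factors makes each path `ξ` of the sum at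
least as long as both: the term of `ξ` is zero or `s_α s_{β^*}` with `ν α = ξ = μ β`. -/
theorem sGhost_mul_sPath_mem_component (hfin : Λ.RowFinite) (μ ν : Λ.Path) :
    Λ.sGhost R ν * Λ.sPath R μ ∈ Λ.component R (degDiff μ ν) := by
  rw [← p_mul_sPath μ, p_eq_sum hfin (Λ.r μ) (Λ.d μ ⊔ Λ.d ν), Finset.sum_mul, Finset.mul_sum]
  refine Submodule.sum_mem _ fun ξ hξ => ?_
  have hd : Λ.d ξ = Λ.d μ ⊔ Λ.d ν := ((hfin _ _).mem_toFinset.1 hξ).2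
  have h1 := sGhost_mul_sPath_of_le (R := R) (μ := ξ) (ν := ν) (hd ▸ le_sup_right)
  have h2 := sGhost_mul_sPath_of_ge (R := R) (μ := ξ) (ν := μ) (hd ▸ le_sup_left)
  rw [mul_assoc, ← mul_assoc]
  rcases h1 with h1 | ⟨α, hα, hα', h1⟩
  · rw [h1, zero_mul]; exact Submodule.zero_mem _
  rcases h2 with h2 | ⟨β, hβ, hβ', h2⟩
  · rw [h2, mul_zero]; exact Submodule.zero_mem _
  rw [h1, h2]
  refine Submodule.subset_span ⟨α, β, fun i => ?_, rfl⟩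
  have h3 := congrArg (fun ζ => Λ.d ζ i) (hα'.trans hβ'.symm)
  simp only [Λ.d_comp, Pi.add_apply] at h3
  unfold degDiff
  omega

/-- In a product of two spanning elements only the inner factor `s_{ν^*} s_α` is out of order. Once
it is rewritten as a combination of `s_γ s_{δ^*}`, the outer factors are absorbed by composition. -/
theorem mul_mem_component (hfin : Λ.RowFinite) {m n : Fin k → ℤ} {x y : Λ.KP R}
    (hx : x ∈ Λ.component R m) (hy : y ∈ Λ.component R n) :
    x * y ∈ Λ.component R (m + n) := by
  refine Submodule.span_induction ?_ ?_ ?_ ?_ hx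
  · rintro _ ⟨μ, ν, hμν, rfl⟩
    refine Submodule.span_induction ?_ ?_ ?_ ?_ hy
    · rintro _ ⟨α, β, hαβ, rfl⟩
      have h1 : Λ.sPath R μ * Λ.sGhost R ν * (Λ.sPath R α * Λ.sGhost R β) =
          Λ.sPath R μ * (Λ.sGhost R ν * Λ.sPath R α) * Λ.sGhost R β := by
        simp only [mul_assoc]
      rw [h1]
      refine Submodule.span_induction
        (p := fun z _ => Λ.sPath R μ * z * Λ.sGhost R β ∈ Λ.component R (m + n)) ?_ ?_ ?_ ?_
        (sGhost_mul_sPath_mem_component hfin α ν)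
      · rintro _ ⟨γ, δ, hγδ, rfl⟩
        have h2 : Λ.sPath R μ * (Λ.sPath R γ * Λ.sGhost R δ) * Λ.sGhost R β =
            Λ.sPath R μ * Λ.sPath R γ * (Λ.sGhost R δ * Λ.sGhost R β) := by
          simp only [mul_assoc]
        rw [h2]
        by_cases hμ : Λ.s μ = Λ.r γ
        swap
        · rw [sPath_mul_sPath_of_ne hμ, zero_mul]; exact Submodule.zero_mem _
        by_cases hβ : Λ.s β = Λ.r δ
        swap
        · rw [sGhost_mul_sGhost_of_ne hβ, mul_zero]; exact Submodule.zero_mem _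
        rw [sPath_mul_sPath hμ, sGhost_mul_sGhost hβ]
        refine Submodule.subset_span ⟨_, _, fun i => ?_, rfl⟩
        have e1 := hμν i
        have e2 := hαβ i
        have e3 := hγδ i
        simp only [degDiff] at e3
        simp only [Λ.d_comp, Pi.add_apply]
        push_cast
        linarith
      · rw [mul_zero, zero_mul]; exact Submodule.zero_mem _
      · intro y z _ _ h3 h4
        rw [mul_add, add_mul]; exact Submodule.add_mem _ h3 h4
      · intro a y _ h3
        rw [mul_smul_comm, smul_mul_assoc]; exact Submodule.smul_mem _ _ h3
    · rw [mul_zero]; exact Submodule.zero_mem _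
    · intro y z _ _ h3 h4
      rw [mul_add]; exact Submodule.add_mem _ h3 h4
    · intro a y _ h3
      rw [mul_smul_comm]; exact Submodule.smul_mem _ _ h3
  · rw [zero_mul]; exact Submodule.zero_mem _
  · intro y z _ _ h3 h4
    rw [add_mul]; exact Submodule.add_mem _ h3 h4
  · intro a y _ h3
    rw [smul_mul_assoc]; exact Submodule.smul_mem _ _ h3

end Relations

/-! ### The grading by `ℤ^k` -/

section Grading

variable {k : ℕ} {Λ : KGraph.{u, v} k} {R : Type w} [CommRing R]

/-- The degree of a generator. -/
def Gen.deg : Λ.Gen → Fin k → ℤ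
  | vertex _ => 0
  | path μ _ => fun i => (Λ.d μ i : ℤ)
  | ghost μ _ => fun i => -(Λ.d μ i : ℤ)

/-- The degree of a word in the generators. -/
def wordDeg : FreeSemigroup Λ.Gen →ₙ* Multiplicative (Fin k → ℤ) :=
  FreeSemigroup.lift fun g => Multiplicative.ofAdd g.deg

theorem wordDeg_of (g : Λ.Gen) : (wordDeg (FreeSemigroup.of g)).toAdd = g.deg := rfl

theorem wordDeg_mul (w z : FreeSemigroup Λ.Gen) :
    (wordDeg (w * z)).toAdd = (wordDeg w).toAdd + (wordDeg z).toAdd := by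
  rw [map_mul, toAdd_mul]

open Classical in
/-- The projection of the free algebra onto its component of degree `n`. -/
noncomputable def freeProj (n : Fin k → ℤ) : Λ.FreeAlg R →ₗ[R] Λ.FreeAlg R where
  toFun x := MonoidAlgebra.ofCoeff (x.coeff.filter fun w => (wordDeg w).toAdd = n)
  map_add' x y := by
    rw [MonoidAlgebra.coeff_add, Finsupp.filter_add, MonoidAlgebra.ofCoeff_add]
  map_smul' a x := by
    rw [MonoidAlgebra.coeff_smul, Finsupp.filter_smul, MonoidAlgebra.ofCoeff_smul, RingHom.id_apply]

open Classical in
theorem freeProj_single (n : Fin k → ℤ) (w : FreeSemigroup Λ.Gen) (a : R) :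
    freeProj n (MonoidAlgebra.single w a : Λ.FreeAlg R) =
      if (wordDeg w).toAdd = n then MonoidAlgebra.single w a else 0 := by
  change MonoidAlgebra.ofCoeff (Finsupp.filter _ (Finsupp.single w a)) = _
  split_ifs with h
  · rw [Finsupp.filter_single_of_pos (fun w => (wordDeg w).toAdd = n) h]; rfl
  · rw [Finsupp.filter_single_of_neg (fun w => (wordDeg w).toAdd = n) h]; rfl

theorem freeProj_single_mul (n : Fin k → ℤ) (w : FreeSemigroup Λ.Gen) (a : R) (x : Λ.FreeAlg R) :
    freeProj n (MonoidAlgebra.single w a * x) =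
      MonoidAlgebra.single w a * freeProj (n - (wordDeg w).toAdd) x := by
  induction x using MonoidAlgebra.induction_linear with
  | zero => simp only [mul_zero, map_zero]
  | add x y hx hy => simp only [mul_add, map_add, hx, hy]
  | single z b =>
    rw [MonoidAlgebra.single_mul_single, freeProj_single, freeProj_single, wordDeg_mul]
    simp only [eq_sub_iff_add_eq, add_comm (wordDeg z).toAdd]
    split_ifs
    · rw [MonoidAlgebra.single_mul_single]
    · rw [mul_zero]

theorem freeProj_mul_single (n : Fin k → ℤ) (w : FreeSemigroup Λ.Gen) (a : R) (x : Λ.FreeAlg R) :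
    freeProj n (x * MonoidAlgebra.single w a) =
      freeProj (n - (wordDeg w).toAdd) x * MonoidAlgebra.single w a := by
  induction x using MonoidAlgebra.induction_linear with
  | zero => simp only [zero_mul, map_zero]
  | add x y hx hy => simp only [add_mul, map_add, hx, hy]
  | single z b =>
    rw [MonoidAlgebra.single_mul_single, freeProj_single, freeProj_single, wordDeg_mul]
    simp only [eq_sub_iff_add_eq]
    split_ifs
    · rw [MonoidAlgebra.single_mul_single]
    · rw [zero_mul]

/-- An element of the free algebra is homogeneous of degree `m`. -/
def IsHomog (m : Fin k → ℤ) (x : Λ.FreeAlg R) : Prop :=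
  freeProj m x = x ∧ ∀ n, n ≠ m → freeProj n x = 0

theorem IsHomog.sub {m : Fin k → ℤ} {x y : Λ.FreeAlg R} (hx : IsHomog m x) (hy : IsHomog m y) :
    IsHomog m (x - y) :=
  ⟨by rw [map_sub, hx.1, hy.1], fun n hn => by rw [map_sub, hx.2 n hn, hy.2 n hn, sub_zero]⟩

theorem IsHomog.sum {ι : Type*} {m : Fin k → ℤ} (F : Finset ι) (f : ι → Λ.FreeAlg R)
    (hf : ∀ i ∈ F, IsHomog m (f i)) : IsHomog m (∑ i ∈ F, f i) :=
  ⟨by rw [map_sum]; exact Finset.sum_congr rfl fun i hi => (hf i hi).1,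
    fun n hn => by rw [map_sum]; exact Finset.sum_eq_zero fun i hi => (hf i hi).2 n hn⟩

theorem isHomog_gen (g : Λ.Gen) : IsHomog g.deg (Λ.gen R g) := by
  constructor
  · rw [gen, freeProj_single, wordDeg_of, if_pos rfl]
  · intro n hn
    rw [gen, freeProj_single, wordDeg_of, if_neg hn.symm]

theorem IsHomog.gen_mul {m : Fin k → ℤ} {x : Λ.FreeAlg R} (g : Λ.Gen) (hx : IsHomog m x) :
    IsHomog (g.deg + m) (Λ.gen R g * x) := by
  constructor
  · rw [gen, freeProj_single_mul, wordDeg_of, add_sub_cancel_left, hx.1]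
  · intro n hn
    rw [gen, freeProj_single_mul, wordDeg_of, hx.2 _ fun h => hn (by rw [← h]; abel), mul_zero]

/-- With ghosts in degree `-d(μ)`, the terms of every relation have the same degree; this is what
lets the grading descend from the free algebra. -/
theorem Rel.isHomog {x : Λ.FreeAlg R} (h : Rel Λ R x) : ∃ m, IsHomog m x := by
  have h2 (g g' : Λ.Gen) : IsHomog (g.deg + g'.deg) (Λ.gen R g * Λ.gen R g') :=
    (isHomog_gen g').gen_mul g
  have h3 (g g' g'' : Λ.Gen) (he : g.deg + g'.deg = g''.deg) :
      ∃ m, IsHomog m (Λ.gen R g * Λ.gen R g' - Λ.gen R g'') :=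
    ⟨_, (h2 g g').sub (he ▸ isHomog_gen g'')⟩
  cases h with
  | idem x => exact h3 _ _ _ (add_zero 0)
  | orthogonal x y _ => exact ⟨_, h2 _ _⟩
  | path_mul μ ν hμ hν h hμν =>
    refine h3 _ _ _ (funext fun i => ?_)
    simp only [Gen.deg, Pi.add_apply, Λ.d_comp, Nat.cast_add]
  | ghost_mul μ ν hμ hν h hμν =>
    refine h3 _ _ _ (funext fun i => ?_)
    simp only [Gen.deg, Pi.add_apply, Λ.d_comp, Nat.cast_add, neg_add_rev]
  | range_path μ hμ => exact h3 _ _ _ (zero_add _)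
  | path_source μ hμ => exact h3 _ _ _ (add_zero _)
  | source_ghost μ hμ => exact h3 _ _ _ (zero_add _)
  | ghost_range μ hμ => exact h3 _ _ _ (add_zero _)
  | ghost_path_self μ hμ => exact h3 _ _ _ (neg_add_cancel _)
  | ghost_path_of_ne μ ν hμ hν hd hμν => exact ⟨_, h2 _ _⟩
  | sum_path_ghost x n hn hfin =>
    refine ⟨0, (isHomog_gen (Gen.vertex x)).sub (IsHomog.sum _ _ fun μ _ => ?_)⟩
    have h4 := h2 (Gen.path μ.1 (((hfin.mem_toFinset.1 μ.2).2).trans_ne hn))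
      (Gen.ghost μ.1 (((hfin.mem_toFinset.1 μ.2).2).trans_ne hn))
    rwa [show Gen.deg (Gen.path μ.1 _) + Gen.deg (Gen.ghost μ.1 _) = 0 from
      add_neg_cancel (G := Fin k → ℤ) _] at h4

/-- Multipliers can be taken to be monomials, and multiplication by a monomial merely shifts the
index of the projection. -/
theorem freeProj_mem_relIdeal (x : Λ.FreeAlg R) (hx : x ∈ Λ.relIdeal R) (n : Fin k → ℤ) :
    freeProj n x ∈ Λ.relIdeal R := by
  induction hx using TwoSidedIdeal.span_induction generalizing n with
  | mem x h =>
    obtain ⟨a, y, hy, rfl⟩ := h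
    obtain ⟨m, hm⟩ := hy.isHomog
    rw [map_smul]
    refine Λ.smul_mem_relIdeal R a _ ?_
    by_cases hn : n = m
    · rw [hn, hm.1]
      exact TwoSidedIdeal.subset_span ⟨1, y, hy, (one_smul R y).symm⟩
    · rw [hm.2 n hn]; exact TwoSidedIdeal.zero_mem _
  | zero => rw [map_zero]; exact TwoSidedIdeal.zero_mem _
  | add x y _ _ hx hy => rw [map_add]; exact TwoSidedIdeal.add_mem _ (hx n) (hy n)
  | neg x _ hx => rw [map_neg]; exact TwoSidedIdeal.neg_mem _ (hx n)
  | left_absorb b x _ hx =>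
    induction b using MonoidAlgebra.induction_linear with
    | zero => rw [zero_mul, map_zero]; exact TwoSidedIdeal.zero_mem _
    | add b c hb hc => rw [add_mul, map_add]; exact TwoSidedIdeal.add_mem _ hb hc
    | single w a => rw [freeProj_single_mul]; exact TwoSidedIdeal.mul_mem_left _ _ _ (hx _)
  | right_absorb b x _ hx =>
    induction b using MonoidAlgebra.induction_linear with
    | zero => rw [mul_zero, map_zero]; exact TwoSidedIdeal.zero_mem _
    | add b c hb hc => rw [mul_add, map_add]; exact TwoSidedIdeal.add_mem _ hb hc
    | single w a => rw [freeProj_mul_single]; exact TwoSidedIdeal.mul_mem_right _ _ _ (hx _)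

/-- The projection of `KP_R(Λ)` onto its component of degree `n`. -/
noncomputable def proj (n : Fin k → ℤ) : Λ.KP R →ₗ[R] Λ.KP R where
  toFun := Quotient.map' (freeProj n) fun x y h => by
    have h' : (Λ.relIdeal R).ringCon x y := h
    change (Λ.relIdeal R).ringCon _ _
    rw [TwoSidedIdeal.rel_iff] at h' ⊢
    rw [← map_sub]
    exact freeProj_mem_relIdeal _ h' n
  map_add' x y := by
    obtain ⟨x, rfl⟩ := Λ.toKP_surjective R x
    obtain ⟨y, rfl⟩ := Λ.toKP_surjective R y
    exact congrArg (Λ.toKP R) (map_add (freeProj n) x y)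
  map_smul' a x := by
    obtain ⟨x, rfl⟩ := Λ.toKP_surjective R x
    exact congrArg (Λ.toKP R) (map_smul (freeProj n) a x)

theorem proj_toKP (n : Fin k → ℤ) (x : Λ.FreeAlg R) :
    proj n (Λ.toKP R x) = Λ.toKP R (freeProj n x) := rfl

theorem toKP_gen_mem_component (g : Λ.Gen) : Λ.toKP R (Λ.gen R g) ∈ Λ.component R g.deg := by
  cases g with
  | vertex x => exact p_mem_component x
  | path μ h => rw [← sPath_of_d_ne_zero h]; exact sPath_mem_component μ
  | ghost μ h => rw [← sGhost_of_d_ne_zero h]; exact sGhost_mem_component μ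

theorem single_eq_smul (w : FreeSemigroup Λ.Gen) (a : R) :
    (MonoidAlgebra.single w a : Λ.FreeAlg R) = a • MonoidAlgebra.single w 1 := by
  rw [MonoidAlgebra.smul_single, smul_eq_mul, mul_one]

theorem single_of_mul (g : Λ.Gen) (w : FreeSemigroup Λ.Gen) :
    (MonoidAlgebra.single (FreeSemigroup.of g * w) 1 : Λ.FreeAlg R) =
      Λ.gen R g * MonoidAlgebra.single w 1 := by
  rw [gen, MonoidAlgebra.single_mul_single, one_mul]

theorem toKP_single_mem_component (hfin : Λ.RowFinite) (w : FreeSemigroup Λ.Gen) (a : R) :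
    Λ.toKP R (MonoidAlgebra.single w a) ∈ Λ.component R (wordDeg w).toAdd := by
  rw [single_eq_smul, toKP_smul]
  refine Submodule.smul_mem _ _ ?_
  induction w using FreeSemigroup.recOnMul with
  | ih1 g => exact toKP_gen_mem_component g
  | ih2 g w _ hw =>
    rw [single_of_mul, toKP_mul, wordDeg_mul]
    exact mul_mem_component hfin (toKP_gen_mem_component g) hw

/-- Both cases in the definition of `s_μ` give the class of one word of degree `d(μ)`, so
projections of `s_μ s_{ν^*}` can be computed on words. -/
theorem exists_single_eq_sPath (μ : Λ.Path) :
    ∃ w : FreeSemigroup Λ.Gen, Λ.sPath R μ = Λ.toKP R (MonoidAlgebra.single w 1) ∧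
      (wordDeg w).toAdd = fun i => (Λ.d μ i : ℤ) := by
  by_cases h : Λ.d μ = 0
  · refine ⟨.of (.vertex (Λ.r μ)), sPath_of_d_eq_zero h, funext fun i => ?_⟩
    rw [h]; rfl
  · exact ⟨.of (.path μ h), sPath_of_d_ne_zero h, rfl⟩

theorem exists_single_eq_sGhost (μ : Λ.Path) :
    ∃ w : FreeSemigroup Λ.Gen, Λ.sGhost R μ = Λ.toKP R (MonoidAlgebra.single w 1) ∧
      (wordDeg w).toAdd = fun i => -(Λ.d μ i : ℤ) := by
  by_cases h : Λ.d μ = 0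
  · refine ⟨.of (.vertex (Λ.r μ)), sGhost_of_d_eq_zero h, funext fun i => ?_⟩
    rw [h]; rfl
  · exact ⟨.of (.ghost μ h), sGhost_of_d_ne_zero h, rfl⟩

open Classical in
theorem proj_of_mem_component {m : Fin k → ℤ} {x : Λ.KP R} (hx : x ∈ Λ.component R m)
    (n : Fin k → ℤ) : proj n x = if m = n then x else 0 := by
  refine Submodule.span_induction ?_ ?_ ?_ ?_ hx
  · rintro _ ⟨μ, ν, hμν, rfl⟩
    obtain ⟨w, hw, hw'⟩ := exists_single_eq_sPath (R := R) μ
    obtain ⟨z, hz, hz'⟩ := exists_single_eq_sGhost (R := R) ν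
    have h1 : (wordDeg (w * z)).toAdd = m := by
      rw [wordDeg_mul, hw', hz']
      exact funext hμν
    rw [hw, hz, ← toKP_mul, MonoidAlgebra.single_mul_single, proj_toKP, freeProj_single, h1]
    split_ifs <;> rfl
  · rw [map_zero, ite_self]
  · intro x y _ _ hx hy
    rw [map_add, hx, hy]
    split_ifs
    · rfl
    · exact add_zero 0
  · intro a x _ hx
    rw [map_smul, hx]
    split_ifs
    · rfl
    · exact smul_zero a

theorem exists_finsupp_components (hfin : Λ.RowFinite) (x : Λ.KP R) :
    ∃ f : (Fin k → ℤ) →₀ Λ.KP R, (∀ n, f n ∈ Λ.component R n) ∧ (f.sum fun _ y => y) = x := by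
  obtain ⟨x, rfl⟩ := Λ.toKP_surjective R x
  induction x using MonoidAlgebra.induction_linear with
  | zero => exact ⟨0, fun n => Submodule.zero_mem _, Finsupp.sum_zero_index⟩
  | add x y hx hy =>
    obtain ⟨f, hf, hf'⟩ := hx
    obtain ⟨g, hg, hg'⟩ := hy
    refine ⟨f + g, fun n => Submodule.add_mem _ (hf n) (hg n), ?_⟩
    rw [Finsupp.sum_add_index' (fun _ => rfl) (fun _ _ _ => rfl), hf', hg', toKP_add]
  | single w a =>
    refine ⟨Finsupp.single (wordDeg w).toAdd (Λ.toKP R (MonoidAlgebra.single w a)), fun n => ?_,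
      Finsupp.sum_single_index rfl⟩
    classical
    rw [Finsupp.single_apply]
    split_ifs with h
    · exact h ▸ toKP_single_mem_component hfin w a
    · exact Submodule.zero_mem _

/-- The projections recover the summands, so a decomposition into homogeneous components is unique.
-/
theorem proj_finsupp_sum {f : (Fin k → ℤ) →₀ Λ.KP R} (hf : ∀ n, f n ∈ Λ.component R n)
    (n : Fin k → ℤ) : proj n (f.sum fun _ y => y) = f n := by
  classical
  rw [Finsupp.sum, map_sum]
  simp only [proj_of_mem_component (hf _) n]
  rw [Finset.sum_ite_eq' f.support n f]
  split_ifs with h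
  · rfl
  · exact (Finsupp.notMem_support_iff.1 h).symm

theorem proj_mem_component (hfin : Λ.RowFinite) (n : Fin k → ℤ) (x : Λ.KP R) :
    proj n x ∈ Λ.component R n := by
  obtain ⟨f, hf, rfl⟩ := exists_finsupp_components hfin x
  rw [proj_finsupp_sum hf]
  exact hf n

theorem exists_proj_ne_zero (hfin : Λ.RowFinite) {x : Λ.KP R} (hx : x ≠ 0) :
    ∃ n, proj n x ≠ 0 := by
  obtain ⟨f, hf, rfl⟩ := exists_finsupp_components hfin x
  by_contra! h
  refine hx (Finset.sum_eq_zero fun n _ => ?_)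
  rw [← proj_finsupp_sum hf n]
  exact h n

/-- The uniqueness clause of `IsGraded` is automatic by `proj_finsupp_sum`; only the stability of
`I` under the projections remains. -/
theorem isGraded_iff (hfin : Λ.RowFinite) {I : TwoSidedIdeal (Λ.KP R)} :
    IsGraded I ↔ ∀ x ∈ I, ∀ n, proj n x ∈ I := by
  constructor
  · intro h x hx n
    obtain ⟨f, ⟨hf, rfl⟩, -⟩ := h x hx
    rw [proj_finsupp_sum fun n => (hf n).2]
    exact (hf n).1
  · intro h x hx
    obtain ⟨f, hf, rfl⟩ := exists_finsupp_components hfin x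
    refine ⟨f, ⟨fun n => ⟨?_, hf n⟩, rfl⟩, ?_⟩
    · rw [← proj_finsupp_sum hf n]
      exact h _ hx n
    · rintro g ⟨hg, hgf⟩
      ext n
      rw [← proj_finsupp_sum hf n, ← hgf, proj_finsupp_sum fun n => (hg n).2]

/-- An ideal which contains the homogeneous components of generators of it is graded. -/
theorem isGraded_span (hfin : Λ.RowFinite) {S : Set (Λ.KP R)}
    (hS : ∀ x ∈ S, ∃ n, x ∈ Λ.component R n) : IsGraded (TwoSidedIdeal.span S) := by
  rw [isGraded_iff hfin]
  intro x hx n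
  induction hx using TwoSidedIdeal.span_induction generalizing n with
  | mem x h =>
    obtain ⟨m, hm⟩ := hS x h
    classical
    rw [proj_of_mem_component hm]
    split_ifs
    · exact TwoSidedIdeal.subset_span h
    · exact TwoSidedIdeal.zero_mem _
  | zero => rw [map_zero]; exact TwoSidedIdeal.zero_mem _
  | add x y _ _ hx hy => rw [map_add]; exact TwoSidedIdeal.add_mem _ (hx n) (hy n)
  | neg x _ hx => rw [map_neg]; exact TwoSidedIdeal.neg_mem _ (hx n)
  | left_absorb b x _ hx =>
    obtain ⟨b, rfl⟩ := Λ.toKP_surjective R b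
    obtain ⟨x, rfl⟩ := Λ.toKP_surjective R x
    rw [← toKP_mul, proj_toKP]
    induction b using MonoidAlgebra.induction_linear with
    | zero => rw [zero_mul, map_zero]; exact TwoSidedIdeal.zero_mem _
    | add b c hb hc => rw [add_mul, map_add, toKP_add]; exact TwoSidedIdeal.add_mem _ hb hc
    | single w a =>
      rw [freeProj_single_mul, toKP_mul]
      exact TwoSidedIdeal.mul_mem_left _ _ _ (hx _)
  | right_absorb b x _ hx =>
    obtain ⟨b, rfl⟩ := Λ.toKP_surjective R b
    obtain ⟨x, rfl⟩ := Λ.toKP_surjective R x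
    rw [← toKP_mul, proj_toKP]
    induction b using MonoidAlgebra.induction_linear with
    | zero => rw [mul_zero, map_zero]; exact TwoSidedIdeal.zero_mem _
    | add b c hb hc => rw [mul_add, map_add, toKP_add]; exact TwoSidedIdeal.add_mem _ hb hc
    | single w a =>
      rw [freeProj_mul_single, toKP_mul]
      exact TwoSidedIdeal.mul_mem_right _ _ _ (hx _)

end Grading

/-! ### Normal forms and coefficients of homogeneous elements -/

section Levels

variable {k : ℕ} {Λ : KGraph.{u, v} k} {R : Type w} [CommRing R]

variable (Λ) in
/-- Pairs of paths of given degrees with a common source. -/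
abbrev LevelPair (M N : Fin k → ℕ) : Type v :=
  {q : Λ.Path × Λ.Path // Λ.d q.1 = M ∧ Λ.d q.2 = N ∧ Λ.s q.1 = Λ.s q.2}

variable (Λ R) in
/-- The span of the `s_μ s_{ν^*}` with `μ` and `ν` of given degrees. -/
noncomputable def level (M N : Fin k → ℕ) : Submodule R (Λ.KP R) :=
  Submodule.span R
    (Set.range fun q : Λ.LevelPair M N => Λ.sPath R q.1.1 * Λ.sGhost R q.1.2)

theorem sPath_mul_sGhost_mem_level {M N : Fin k → ℕ} {μ ν : Λ.Path} (hμ : Λ.d μ = M)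
    (hν : Λ.d ν = N) : Λ.sPath R μ * Λ.sGhost R ν ∈ Λ.level R M N := by
  by_cases h : Λ.s μ = Λ.s ν
  · exact Submodule.subset_span ⟨⟨(μ, ν), hμ, hν, h⟩, rfl⟩
  · rw [sPath_mul_sGhost_of_s_ne h]; exact Submodule.zero_mem _

/-- Insert `p_{s(μ)} = ∑ s_ξ s_{ξ^*}`, over paths `ξ` of degree `l`, between `s_μ` and `s_{ν^*}`. -/
theorem level_le_add (hfin : Λ.RowFinite) (M N l : Fin k → ℕ) :
    Λ.level R M N ≤ Λ.level R (M + l) (N + l) := by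
  refine Submodule.span_le.2 ?_
  rintro _ ⟨⟨⟨μ, ν⟩, hμ, hν, hs⟩, rfl⟩
  change Λ.sPath R μ * Λ.sGhost R ν ∈ Λ.level R (M + l) (N + l)
  rw [← sPath_mul_p μ, p_eq_sum hfin (Λ.s μ) l, Finset.mul_sum, Finset.sum_mul]
  refine Submodule.sum_mem _ fun ξ hξ => ?_
  obtain ⟨hr, hd⟩ := (hfin _ _).mem_toFinset.1 hξ
  rw [← mul_assoc, mul_assoc, sPath_mul_sPath hr.symm, sGhost_mul_sGhost (hs.symm.trans hr.symm)]
  exact sPath_mul_sGhost_mem_level (by rw [Λ.d_comp, hd]; exact congrArg (· + l) hμ)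
    (by rw [Λ.d_comp, hd]; exact congrArg (· + l) hν)

/-- A homogeneous element is a combination of elements `s_μ s_{ν^*}` in which all the `μ` have the
same degree and all the `ν` have the same degree. -/
theorem exists_mem_level (hfin : Λ.RowFinite) {n : Fin k → ℤ} {x : Λ.KP R}
    (hx : x ∈ Λ.component R n) :
    ∃ M N : Fin k → ℕ, (∀ i, (M i : ℤ) - (N i : ℤ) = n i) ∧ x ∈ Λ.level R M N := by
  refine Submodule.span_induction ?_ ?_ ?_ ?_ hx
  · rintro _ ⟨μ, ν, h, rfl⟩
    exact ⟨_, _, h, sPath_mul_sGhost_mem_level rfl rfl⟩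
  · exact ⟨fun i => (n i).toNat, fun i => (-n i).toNat, fun i => by dsimp only; omega,
      Submodule.zero_mem _⟩
  · rintro x y _ _ ⟨M, N, h, hx⟩ ⟨M', N', h', hy⟩
    -- Both `M - N` and `M' - N'` equal `n`, so raising the first level by `N'` and the second by
    -- `N` leads to the same level.
    have e : M' + N = M + N' := funext fun i => by
      have h1 := h i
      have h2 := h' i
      simp only [Pi.add_apply]
      omega
    refine ⟨M + N', N + N', fun i => ?_, Submodule.add_mem _ (level_le_add hfin M N N' hx) ?_⟩
    · have h1 := h i
      simp only [Pi.add_apply]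
      omega
    · rw [← e, add_comm N N']
      exact level_le_add hfin M' N' N hy
  · rintro a x _ ⟨M, N, h, hx⟩
    exact ⟨M, N, h, Submodule.smul_mem _ _ hx⟩

/-- Equality of degrees makes (KP3) apply on either side, as for matrix units; the common source in
`LevelPair` keeps the product for `t = q` from vanishing. -/
theorem sGhost_mul_levelPair_mul_sPath {M N : Fin k → ℕ} (q t : Λ.LevelPair M N) [Decidable (t = q)] :
    Λ.sGhost R q.1.1 * (Λ.sPath R t.1.1 * Λ.sGhost R t.1.2) * Λ.sPath R q.1.2 =
      if t = q then Λ.p R (Λ.s q.1.1) else 0 := by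
  obtain ⟨⟨μ, ν⟩, hμ, hν, hs⟩ := q
  obtain ⟨⟨α, β⟩, hα, hβ, hs'⟩ := t
  have h1 : Λ.sGhost R μ * (Λ.sPath R α * Λ.sGhost R β) * Λ.sPath R ν =
      (Λ.sGhost R μ * Λ.sPath R α) * (Λ.sGhost R β * Λ.sPath R ν) := by
    simp only [mul_assoc]
  refine h1.trans ?_
  by_cases e₁ : μ = α
  · by_cases e₂ : β = ν
    · subst e₁ e₂
      rw [if_pos rfl, sGhost_mul_sPath_self, sGhost_mul_sPath_self]
      have hs2 : Λ.s μ = Λ.s β := hs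
      exact (congrArg (Λ.p R (Λ.s μ) * Λ.p R ·) hs2.symm).trans (p_mul_p_self _)
    · rw [sGhost_mul_sPath_of_ne (hβ.trans hν.symm) e₂, mul_zero, if_neg]
      exact fun h => e₂ (congrArg (fun q => q.1.2) h)
  · rw [sGhost_mul_sPath_of_ne (hμ.trans hα.symm) e₁, zero_mul, if_neg]
    exact fun h => e₁ (congrArg (fun q => q.1.1) h).symm

/-- The coefficients of a homogeneous element can be read off by compressing it. -/
theorem exists_coefficients {M N : Fin k → ℕ} {x : Λ.KP R} (hx : x ∈ Λ.level R M N) :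
    ∃ c : Λ.LevelPair M N →₀ R,
      (c.sum fun q a => a • (Λ.sPath R q.1.1 * Λ.sGhost R q.1.2)) = x ∧
      ∀ q, Λ.sGhost R q.1.1 * x * Λ.sPath R q.1.2 = c q • Λ.p R (Λ.s q.1.1) := by
  classical
  obtain ⟨c, hc⟩ := Finsupp.mem_span_range_iff_exists_finsupp.1 hx
  refine ⟨c, hc, fun q => ?_⟩
  rw [← hc, Finsupp.sum, Finset.mul_sum, Finset.sum_mul]
  simp only [mul_smul_comm, smul_mul_assoc, sGhost_mul_levelPair_mul_sPath, smul_ite, smul_zero]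
  rw [Finset.sum_ite_eq' c.support q fun t => c t • Λ.p R (Λ.s q.1.1)]
  split_ifs with h
  · rfl
  · rw [Finsupp.notMem_support_iff.1 h, zero_smul]

/-- The start of both uniqueness theorems: some coefficient of a nonzero element is nonzero. Only `a
≠ 0` is needed later, since basic ideals are tested on scalars. -/
theorem exists_compression_of_ne_zero (hfin : Λ.RowFinite) {n : Fin k → ℤ} {x : Λ.KP R}
    (hx : x ∈ Λ.component R n) (hx0 : x ≠ 0) :
    ∃ (μ ν : Λ.Path) (a : R), degDiff μ ν = n ∧ a ≠ 0 ∧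
      Λ.sGhost R μ * x * Λ.sPath R ν = a • Λ.p R (Λ.s μ) := by
  obtain ⟨M, N, hn, hx⟩ := exists_mem_level hfin hx
  obtain ⟨c, hc, hc'⟩ := exists_coefficients hx
  have h1 : ∃ q, c q ≠ 0 := by
    by_contra! h
    refine hx0 (hc.symm.trans (Finset.sum_eq_zero fun q _ => ?_))
    rw [h q]
    exact zero_smul R _
  obtain ⟨q, hq⟩ := h1
  refine ⟨q.1.1, q.1.2, c q, funext fun i => ?_, hq, hc' q⟩
  rw [degDiff, q.2.1, q.2.2.1]
  exact hn i

/-! ### Ideals and their vertex sets -/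

theorem sPath_mul_sGhost_mem {I : TwoSidedIdeal (Λ.KP R)} {μ : Λ.Path} (h : Λ.p R (Λ.s μ) ∈ I)
    (ν : Λ.Path) : Λ.sPath R μ * Λ.sGhost R ν ∈ I := by
  rw [← sPath_mul_p]
  exact TwoSidedIdeal.mul_mem_right _ _ _ (TwoSidedIdeal.mul_mem_left _ _ _ h)

/-- In (KP4) each term `s_μ s_{μ^*}` has the factor `p_{s(μ)}`. -/
theorem isSaturated_vertexSet (hfin : Λ.RowFinite) (I : TwoSidedIdeal (Λ.KP R)) :
    Λ.IsSaturated (vertexSet I) := by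
  intro x n h
  change Λ.p R x ∈ I
  rw [p_eq_sum hfin x n]
  exact sum_mem fun μ hμ => sPath_mul_sGhost_mem (h μ ((hfin x n).mem_toFinset.1 hμ)) μ

theorem idealOf_le_iff {H : Set Λ.Vertex} {I : TwoSidedIdeal (Λ.KP R)} :
    idealOf R H ≤ I ↔ H ⊆ vertexSet I := by
  rw [idealOf, TwoSidedIdeal.span_le]
  exact Set.image_subset_iff

theorem isGraded_idealOf (hfin : Λ.RowFinite) (H : Set Λ.Vertex) : IsGraded (idealOf R H) := by
  refine isGraded_span hfin ?_
  rintro _ ⟨x, -, rfl⟩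
  exact ⟨0, p_mem_component x⟩

/-- A basic graded ideal is generated by the vertex idempotents it contains. -/
theorem idealOf_vertexSet (hfin : Λ.RowFinite) {I : TwoSidedIdeal (Λ.KP R)} (hb : IsBasic I)
    (hg : IsGraded I) : idealOf R (vertexSet I) = I := by
  refine le_antisymm (idealOf_le_iff.2 subset_rfl) fun x hx => ?_
  obtain ⟨f, ⟨hf, rfl⟩, -⟩ := hg x hx
  refine sum_mem fun n _ => ?_
  obtain ⟨M, N, -, h⟩ := exists_mem_level hfin (hf n).2
  obtain ⟨c, hc, hc'⟩ := exists_coefficients h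
  rw [← hc]
  refine sum_mem fun q hq => smul_mem_ideal _ _ _ (sPath_mul_sGhost_mem ?_ _)
  -- Compressing the component, which lies in `I`, gives `c q • p_{s(μ)} ∈ I` for the first path `μ`
  -- of `q`; here `c q ≠ 0`, and `I` is basic.
  refine TwoSidedIdeal.subset_span ⟨_, hb (c q) _ (Finsupp.mem_support_iff.1 hq) ?_, rfl⟩
  rw [← hc' q]
  exact TwoSidedIdeal.mul_mem_right _ _ _ (TwoSidedIdeal.mul_mem_left _ _ _ (hf n).1)

end Levels

/-! ### The universal property -/

section UniversalProperty

variable {k : ℕ} {Λ : KGraph.{u, v} k} {R : Type w} [CommRing R]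
variable {A : Type*} [NonUnitalRing A] [Module R A] [IsScalarTower R A A] [SMulCommClass R A A]

/-- The homomorphism from the free algebra determined by the images of the generators. -/
noncomputable def freeLift (φ : Λ.Gen → A) : Λ.FreeAlg R →ₙₐ[R] A :=
  MonoidAlgebra.liftMagma R (FreeSemigroup.lift φ)

theorem freeLift_gen (φ : Λ.Gen → A) (g : Λ.Gen) : freeLift (R := R) φ (Λ.gen R g) = φ g := by
  rw [freeLift, gen, MonoidAlgebra.liftMagma_apply_apply]
  change ((Finsupp.single (FreeSemigroup.of g) (1 : R)).sum fun w a => a • FreeSemigroup.lift φ w) = _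
  rw [Finsupp.sum_single_index, one_smul]
  · rfl
  · exact zero_smul R _

theorem freeLift_eq_zero {φ : Λ.Gen → A} (hφ : ∀ y : Λ.FreeAlg R, Rel Λ R y → freeLift φ y = 0)
    {x : Λ.FreeAlg R} (hx : x ∈ Λ.relIdeal R) : freeLift φ x = 0 := by
  induction hx using TwoSidedIdeal.span_induction with
  | mem x h =>
    obtain ⟨a, y, hy, rfl⟩ := h
    rw [map_smul, hφ y hy, smul_zero]
  | zero => exact map_zero _
  | add x y _ _ hx hy => rw [map_add, hx, hy, add_zero]
  | neg x _ hx => rw [map_neg, hx, neg_zero]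
  | left_absorb b x _ hx => rw [map_mul, hx, mul_zero]
  | right_absorb b x _ hx => rw [map_mul, hx, zero_mul]

/-- The universal property of `KP_R(Λ)`. -/
noncomputable def lift (φ : Λ.Gen → A)
    (hφ : ∀ y : Λ.FreeAlg R, Rel Λ R y → freeLift φ y = 0) : Λ.KP R →ₙₐ[R] A where
  toFun := Quotient.lift (freeLift φ) fun x y h => by
    have h' : (Λ.relIdeal R).ringCon x y := h
    rw [TwoSidedIdeal.rel_iff] at h'
    rw [← sub_eq_zero, ← map_sub]
    exact freeLift_eq_zero hφ h'
  map_smul' a x := by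
    obtain ⟨x, rfl⟩ := Λ.toKP_surjective R x
    exact map_smul (freeLift φ) a x
  map_zero' := map_zero (freeLift φ)
  map_add' x y := by
    obtain ⟨x, rfl⟩ := Λ.toKP_surjective R x
    obtain ⟨y, rfl⟩ := Λ.toKP_surjective R y
    exact map_add (freeLift φ) x y
  map_mul' x y := by
    obtain ⟨x, rfl⟩ := Λ.toKP_surjective R x
    obtain ⟨y, rfl⟩ := Λ.toKP_surjective R y
    exact map_mul (freeLift φ) x y

theorem lift_gen (φ : Λ.Gen → A) (hφ : ∀ y : Λ.FreeAlg R, Rel Λ R y → freeLift φ y = 0)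
    (g : Λ.Gen) : lift φ hφ (Λ.toKP R (Λ.gen R g)) = φ g :=
  freeLift_gen φ g

end UniversalProperty

/-! ### A representation detecting the vertices outside `H` -/

section Representation

variable {k : ℕ} {Λ : KGraph.{u, v} k} {R : Type w} [CommRing R]

open Classical in
/-- The operator `(s_μ f)(μβ) = f(β)` on functions on the set of paths. -/
noncomputable def shift (μ : Λ.Path) : Module.End R (Λ.Path → R) where
  toFun f ξ := if h : ∃ (β : Λ.Path) (e : Λ.s μ = Λ.r β), Λ.comp μ β e = ξ then f h.choose else 0
  map_add' f g := funext fun ξ => by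
    dsimp only [Pi.add_apply]
    split_ifs
    · rfl
    · exact (add_zero 0).symm
  map_smul' a f := funext fun ξ => by
    dsimp only [Pi.smul_apply, RingHom.id_apply]
    split_ifs
    · rfl
    · exact (smul_zero a).symm

/-- By unique factorization there is only one `β` to choose in the definition of `shift`. -/
theorem shift_comp (μ β : Λ.Path) (h : Λ.s μ = Λ.r β) (f : Λ.Path → R) :
    shift μ f (Λ.comp μ β h) = f β := by
  have h1 : ∃ (β' : Λ.Path) (e : Λ.s μ = Λ.r β'), Λ.comp μ β' e = Λ.comp μ β h := ⟨β, h, rfl⟩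
  refine (dif_pos h1).trans ?_
  obtain ⟨_, h2⟩ := h1.choose_spec
  rw [(comp_inj rfl h2).2]

theorem shift_of_not_exists {μ ξ : Λ.Path} (f : Λ.Path → R)
    (h : ¬ ∃ (β : Λ.Path) (e : Λ.s μ = Λ.r β), Λ.comp μ β e = ξ) : shift μ f ξ = 0 :=
  dif_neg h

open Classical in
/-- The operator `(s_{μ^*} f)(ξ) = f(μξ)` on functions on the set of paths. -/
noncomputable def backshift (μ : Λ.Path) : Module.End R (Λ.Path → R) where
  toFun f ξ := if h : Λ.s μ = Λ.r ξ then f (Λ.comp μ ξ h) else 0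
  map_add' f g := funext fun ξ => by
    dsimp only [Pi.add_apply]
    split_ifs
    · rfl
    · exact (add_zero 0).symm
  map_smul' a f := funext fun ξ => by
    dsimp only [Pi.smul_apply, RingHom.id_apply]
    split_ifs
    · rfl
    · exact (smul_zero a).symm

theorem backshift_of_eq {μ ξ : Λ.Path} (f : Λ.Path → R) (h : Λ.s μ = Λ.r ξ) :
    backshift μ f ξ = f (Λ.comp μ ξ h) := dif_pos h

theorem backshift_of_ne {μ ξ : Λ.Path} (f : Λ.Path → R) (h : Λ.s μ ≠ Λ.r ξ) :
    backshift μ f ξ = 0 := dif_neg h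

open Classical in
/-- Restriction of functions to the paths with range `x`. -/
noncomputable def restrict (x : Λ.Vertex) : Module.End R (Λ.Path → R) where
  toFun f ξ := if Λ.r ξ = x then f ξ else 0
  map_add' f g := funext fun ξ => by
    dsimp only [Pi.add_apply]
    split_ifs
    · rfl
    · exact (add_zero 0).symm
  map_smul' a f := funext fun ξ => by
    dsimp only [Pi.smul_apply, RingHom.id_apply]
    split_ifs
    · rfl
    · exact (smul_zero a).symm

theorem restrict_of_eq {x : Λ.Vertex} {ξ : Λ.Path} (f : Λ.Path → R) (h : Λ.r ξ = x) :
    restrict x f ξ = f ξ := if_pos h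

theorem restrict_of_ne {x : Λ.Vertex} {ξ : Λ.Path} (f : Λ.Path → R) (h : Λ.r ξ ≠ x) :
    restrict x f ξ = 0 := if_neg h

variable (R) in
/-- The functions which vanish on all paths of sufficiently large degree with source outside `H`. -/
def eventuallyZero (H : Set Λ.Vertex) : Submodule R (Λ.Path → R) where
  carrier := {f | ∃ N, ∀ ξ, N ≤ Λ.d ξ → Λ.s ξ ∉ H → f ξ = 0}
  zero_mem' := ⟨0, fun _ _ _ => rfl⟩
  add_mem' := by
    rintro f g ⟨N, hf⟩ ⟨M, hg⟩
    refine ⟨N ⊔ M, fun ξ h h' => ?_⟩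
    rw [Pi.add_apply, hf ξ (le_sup_left.trans h) h', hg ξ (le_sup_right.trans h) h', add_zero]
  smul_mem' := by
    rintro a f ⟨N, hf⟩
    refine ⟨N, fun ξ h h' => ?_⟩
    rw [Pi.smul_apply, hf ξ h h', smul_zero]

/-- The action of the generators on functions on the set of paths. -/
noncomputable def genAction : Λ.Gen → Module.End R (Λ.Path → R)
  | .vertex x => restrict x
  | .path μ _ => shift μ
  | .ghost μ _ => backshift μ

/-- Prefixing or removing `μ` does not change the source of a path, so the condition at `H` is
preserved; only `shift μ` moves the threshold, by `d μ`. -/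
theorem genAction_mem_eventuallyZero (H : Set Λ.Vertex) (g : Λ.Gen) :
    eventuallyZero R H ≤ (eventuallyZero R H).comap (genAction g) := by
  rintro f ⟨N, hf⟩
  cases g with
  | vertex x =>
    refine ⟨N, fun ξ h h' => ?_⟩
    by_cases hx : Λ.r ξ = x
    · exact (restrict_of_eq f hx).trans (hf ξ h h')
    · exact restrict_of_ne f hx
  | path μ _ =>
    refine ⟨Λ.d μ + N, fun ξ h h' => ?_⟩
    by_cases hx : ∃ (β : Λ.Path) (e : Λ.s μ = Λ.r β), Λ.comp μ β e = ξ
    · obtain ⟨β, e, rfl⟩ := hx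
      rw [Λ.d_comp] at h
      rw [Λ.s_comp] at h'
      exact (shift_comp μ β e f).trans (hf β (le_of_add_le_add_left h) h')
    · exact shift_of_not_exists f hx
  | ghost μ _ =>
    refine ⟨N, fun ξ h h' => ?_⟩
    by_cases hx : Λ.s μ = Λ.r ξ
    · refine (backshift_of_eq f hx).trans (hf _ ?_ ?_)
      · rw [Λ.d_comp]
        exact h.trans le_add_self
      · rwa [Λ.s_comp]
    · exact backshift_of_ne f hx

variable (R) in
/-- The action of the generators on germs at infinity of functions on the set of paths. -/
noncomputable def germAction (H : Set Λ.Vertex) (g : Λ.Gen) :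
    Module.End R ((Λ.Path → R) ⧸ eventuallyZero R H) :=
  (eventuallyZero R H).mapQ (eventuallyZero R H) (genAction g) (genAction_mem_eventuallyZero H g)

theorem germ_ext {H : Set Λ.Vertex} {S T : Module.End R ((Λ.Path → R) ⧸ eventuallyZero R H)}
    (h : ∀ f : Λ.Path → R, S (Submodule.Quotient.mk f) = T (Submodule.Quotient.mk f)) : S = T :=
  LinearMap.ext fun x => by
    obtain ⟨f, rfl⟩ := Submodule.Quotient.mk_surjective _ x
    exact h f

/-- All relations except (KP4) hold for the functions themselves, before passing to germs. -/
theorem germAction_mul_eq {H : Set Λ.Vertex} {g g' g'' : Λ.Gen}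
    (h : ∀ (f : Λ.Path → R) ξ, genAction g (genAction g' f) ξ = genAction g'' f ξ) :
    germAction R H g * germAction R H g' - germAction R H g'' = 0 :=
  sub_eq_zero.2 <| germ_ext fun f =>
    congrArg Submodule.Quotient.mk (funext (h f) : genAction g (genAction g' f) = genAction g'' f)

theorem germAction_mul_eq_zero {H : Set Λ.Vertex} {g g' : Λ.Gen}
    (h : ∀ (f : Λ.Path → R) ξ, genAction g (genAction g' f) ξ = 0) :
    germAction R H g * germAction R H g' = 0 :=
  germ_ext fun f =>
    congrArg Submodule.Quotient.mk (funext (h f) : genAction g (genAction g' f) = 0)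

/-- The reason for using germs: a path of degree at least `n` has exactly one initial segment of
degree `n`, so (KP4) holds there, while on other paths the sum vanishes and (KP4) may fail. -/
theorem restrict_sub_sum_mem {H : Set Λ.Vertex} (x : Λ.Vertex) (n : Fin k → ℕ)
    (hfin : (Λ.pathsAt x n).Finite) (f : Λ.Path → R) :
    restrict x f - ∑ μ ∈ hfin.toFinset, shift μ (backshift μ f) ∈ eventuallyZero R H := by
  refine ⟨n, fun ξ hξ _ => ?_⟩
  rw [Pi.sub_apply, Finset.sum_apply, sub_eq_zero]
  obtain ⟨α, β, h, hα, rfl⟩ := exists_comp_eq hξ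
  by_cases hx : Λ.r (Λ.comp α β h) = x
  · rw [restrict_of_eq f hx, Finset.sum_eq_single α]
    · rw [shift_comp, backshift_of_eq f h]
    · intro μ hμ hne
      refine shift_of_not_exists _ ?_
      rintro ⟨γ, e, he⟩
      exact hne (comp_inj ((hfin.mem_toFinset.1 hμ).2.trans hα.symm) he).1
    · intro h'
      rw [Λ.r_comp] at hx
      exact absurd (hfin.mem_toFinset.2 ⟨hx, hα⟩) h'
  · rw [restrict_of_ne f hx]
    refine (Finset.sum_eq_zero fun μ hμ => shift_of_not_exists _ ?_).symm
    rintro ⟨γ, e, he⟩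
    refine hx ?_
    rw [← he, Λ.r_comp]
    exact (hfin.mem_toFinset.1 hμ).1

theorem freeLift_germAction_eq_zero (H : Set Λ.Vertex) (y : Λ.FreeAlg R) (hy : Rel Λ R y) :
    freeLift (germAction R H) y = 0 := by
  cases hy with
  | idem x =>
    rw [map_sub, map_mul, freeLift_gen]
    refine germAction_mul_eq fun f ξ => ?_
    change restrict x (restrict x f) ξ = restrict x f ξ
    by_cases h : Λ.r ξ = x
    · rw [restrict_of_eq _ h]
    · rw [restrict_of_ne _ h, restrict_of_ne _ h]
  | orthogonal x y hxy =>
    rw [map_mul, freeLift_gen, freeLift_gen]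
    refine germAction_mul_eq_zero fun f ξ => ?_
    change restrict x (restrict y f) ξ = 0
    by_cases h : Λ.r ξ = x
    · rw [restrict_of_eq _ h, restrict_of_ne _ (h.trans_ne hxy)]
    · rw [restrict_of_ne _ h]
  | path_mul μ ν hμ hν h hμν =>
    rw [map_sub, map_mul, freeLift_gen, freeLift_gen, freeLift_gen]
    refine germAction_mul_eq fun f ξ => ?_
    change shift μ (shift ν f) ξ = shift (Λ.comp μ ν h) f ξ
    by_cases h1 : ∃ (β : Λ.Path) (e : Λ.s μ = Λ.r β), Λ.comp μ β e = ξ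
    · obtain ⟨β, e, rfl⟩ := h1
      rw [shift_comp]
      by_cases h2 : ∃ (γ : Λ.Path) (e : Λ.s ν = Λ.r γ), Λ.comp ν γ e = β
      · obtain ⟨γ, e', rfl⟩ := h2
        rw [shift_comp, ← Λ.assoc μ ν γ h e', shift_comp]
      · rw [shift_of_not_exists f h2, shift_of_not_exists]
        rintro ⟨γ, e', he⟩
        rw [Λ.assoc μ ν γ h ((Λ.s_comp μ ν h).symm.trans e')] at he
        exact h2 ⟨γ, _, (comp_inj rfl he).2⟩
    · rw [shift_of_not_exists _ h1, shift_of_not_exists]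
      rintro ⟨γ, e', rfl⟩
      exact h1 ⟨_, _, (Λ.assoc μ ν γ h ((Λ.s_comp μ ν h).symm.trans e')).symm⟩
  | ghost_mul μ ν hμ hν h hμν =>
    rw [map_sub, map_mul, freeLift_gen, freeLift_gen, freeLift_gen]
    refine germAction_mul_eq fun f ξ => ?_
    change backshift ν (backshift μ f) ξ = backshift (Λ.comp μ ν h) f ξ
    by_cases h1 : Λ.s ν = Λ.r ξ
    · rw [backshift_of_eq _ h1, backshift_of_eq f (h.trans (Λ.r_comp ν ξ h1).symm),
        backshift_of_eq f ((Λ.s_comp μ ν h).trans h1), Λ.assoc]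
    · rw [backshift_of_ne _ h1, backshift_of_ne]
      rwa [Λ.s_comp]
  | range_path μ hμ =>
    rw [map_sub, map_mul, freeLift_gen, freeLift_gen]
    refine germAction_mul_eq fun f ξ => ?_
    change restrict (Λ.r μ) (shift μ f) ξ = shift μ f ξ
    by_cases h : Λ.r ξ = Λ.r μ
    · rw [restrict_of_eq _ h]
    · rw [restrict_of_ne _ h, shift_of_not_exists]
      rintro ⟨β, e, rfl⟩
      exact h (Λ.r_comp _ _ _)
  | path_source μ hμ =>
    rw [map_sub, map_mul, freeLift_gen, freeLift_gen]
    refine germAction_mul_eq fun f ξ => ?_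
    change shift μ (restrict (Λ.s μ) f) ξ = shift μ f ξ
    by_cases h1 : ∃ (β : Λ.Path) (e : Λ.s μ = Λ.r β), Λ.comp μ β e = ξ
    · obtain ⟨β, e, rfl⟩ := h1
      rw [shift_comp, shift_comp, restrict_of_eq _ e.symm]
    · rw [shift_of_not_exists _ h1, shift_of_not_exists _ h1]
  | source_ghost μ hμ =>
    rw [map_sub, map_mul, freeLift_gen, freeLift_gen]
    refine germAction_mul_eq fun f ξ => ?_
    change restrict (Λ.s μ) (backshift μ f) ξ = backshift μ f ξ
    by_cases h : Λ.r ξ = Λ.s μ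
    · rw [restrict_of_eq _ h]
    · rw [restrict_of_ne _ h, backshift_of_ne _ (Ne.symm h)]
  | ghost_range μ hμ =>
    rw [map_sub, map_mul, freeLift_gen, freeLift_gen]
    refine germAction_mul_eq fun f ξ => ?_
    change backshift μ (restrict (Λ.r μ) f) ξ = backshift μ f ξ
    by_cases h : Λ.s μ = Λ.r ξ
    · rw [backshift_of_eq _ h, backshift_of_eq _ h, restrict_of_eq _ (Λ.r_comp _ _ _)]
    · rw [backshift_of_ne _ h, backshift_of_ne _ h]
  | ghost_path_self μ hμ =>
    rw [map_sub, map_mul, freeLift_gen, freeLift_gen, freeLift_gen]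
    refine germAction_mul_eq fun f ξ => ?_
    change backshift μ (shift μ f) ξ = restrict (Λ.s μ) f ξ
    by_cases h : Λ.s μ = Λ.r ξ
    · rw [backshift_of_eq _ h, shift_comp, restrict_of_eq _ h.symm]
    · rw [backshift_of_ne _ h, restrict_of_ne _ (Ne.symm h)]
  | ghost_path_of_ne μ ν hμ hν hd hμν =>
    rw [map_mul, freeLift_gen, freeLift_gen]
    refine germAction_mul_eq_zero fun f ξ => ?_
    change backshift μ (shift ν f) ξ = 0
    by_cases h : Λ.s μ = Λ.r ξ
    · rw [backshift_of_eq _ h, shift_of_not_exists]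
      rintro ⟨β, e, he⟩
      exact hμν (comp_inj hd.symm he).1.symm
    · rw [backshift_of_ne _ h]
  | sum_path_ghost x n hn hfin =>
    rw [map_sub, map_sum]
    simp only [map_mul, freeLift_gen]
    refine germ_ext fun f => ?_
    rw [LinearMap.sub_apply, LinearMap.sum_apply, LinearMap.zero_apply]
    refine Eq.trans ?_ ((Submodule.Quotient.mk_eq_zero _).2 (restrict_sub_sum_mem x n hfin f))
    rw [Submodule.Quotient.mk_sub, ← Finset.sum_attach hfin.toFinset]
    congr 1
    exact (map_sum (eventuallyZero R H).mkQ _ _).symm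

variable (R) in
/-- The representation of `KP_R(Λ)` on germs at infinity. -/
noncomputable def germRep (H : Set Λ.Vertex) :
    Λ.KP R →ₙₐ[R] Module.End R ((Λ.Path → R) ⧸ eventuallyZero R H) :=
  lift (germAction R H) (freeLift_germAction_eq_zero H)

theorem germRep_p (H : Set Λ.Vertex) (x : Λ.Vertex) (f : Λ.Path → R) :
    germRep R H (Λ.p R x) (Submodule.Quotient.mk f) = Submodule.Quotient.mk (restrict x f) := by
  rw [germRep, p, lift_gen]
  rfl

/-- By heredity a path with range `x ∈ H` has its source in `H`, and germs ignore such paths. -/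
theorem germRep_p_eq_zero {H : Set Λ.Vertex} (hH : Λ.IsHereditary H) {x : Λ.Vertex} (hx : x ∈ H) :
    germRep R H (Λ.p R x) = 0 := by
  refine germ_ext fun f => ?_
  rw [germRep_p, LinearMap.zero_apply, Submodule.Quotient.mk_eq_zero]
  refine ⟨0, fun ξ _ hξ => restrict_of_ne f ?_⟩
  rintro rfl
  exact hξ (hH ξ hx)

theorem germRep_eq_zero_of_mem {H : Set Λ.Vertex} (hH : Λ.IsHereditary H) {z : Λ.KP R}
    (hz : z ∈ idealOf R H) : germRep R H z = 0 := by
  rw [idealOf] at hz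
  induction hz using TwoSidedIdeal.span_induction with
  | mem z h =>
    obtain ⟨x, hx, rfl⟩ := h
    exact germRep_p_eq_zero hH hx
  | zero => exact map_zero _
  | add x y _ _ hx hy => rw [map_add, hx, hy, add_zero]
  | neg x _ hx => rw [map_neg, hx, neg_zero]
  | left_absorb b x _ hx => rw [map_mul, hx, mul_zero]
  | right_absorb b x _ hx => rw [map_mul, hx, zero_mul]

/-- Apply `a p_x` to the constant function `1`. If the result is zero as a germ, with threshold `N`,
no path in `xΛ^N` can have its source outside `H`, and saturation applies. -/
theorem mem_of_smul_p_mem_idealOf {H : Set Λ.Vertex} (hH : Λ.IsHereditary H)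
    (hs : Λ.IsSaturated H) {a : R} (ha : a ≠ 0) {x : Λ.Vertex} (h : a • Λ.p R x ∈ idealOf R H) :
    x ∈ H := by
  by_contra hx
  have h1 := LinearMap.congr_fun (germRep_eq_zero_of_mem hH h)
    (Submodule.Quotient.mk fun _ => (1 : R))
  rw [map_smul, LinearMap.smul_apply, germRep_p, LinearMap.zero_apply,
    ← Submodule.Quotient.mk_smul, Submodule.Quotient.mk_eq_zero] at h1
  obtain ⟨N, hN⟩ := h1
  refine hx (hs x N fun μ hμ => ?_)
  by_contra hμH
  have h2 := hN μ hμ.2.ge hμH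
  rw [Pi.smul_apply, restrict_of_eq _ hμ.1, smul_eq_mul, mul_one] at h2
  exact ha h2

theorem isBasic_idealOf {H : Set Λ.Vertex} (hH : Λ.IsHereditary H) (hs : Λ.IsSaturated H) :
    IsBasic (idealOf R H) := fun _ x ha h =>
  TwoSidedIdeal.subset_span ⟨x, mem_of_smul_p_mem_idealOf hH hs ha h, rfl⟩

theorem vertexSet_idealOf [Nontrivial R] {H : Set Λ.Vertex} (hH : Λ.IsHereditary H)
    (hs : Λ.IsSaturated H) : vertexSet (idealOf R H) = H := by
  refine Set.Subset.antisymm (fun x hx => ?_) fun x hx => TwoSidedIdeal.subset_span ⟨x, hx, rfl⟩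
  refine mem_of_smul_p_mem_idealOf (R := R) hH hs one_ne_zero ?_
  rw [one_smul]
  exact hx

end Representation

/-! ### The graded and the Cuntz-Krieger uniqueness theorems -/

section Uniqueness

variable {k : ℕ} {Λ : KGraph.{u, v} k} {R : Type w} [CommRing R]

theorem IsSegment.d_eq {μ ν : Λ.Path} {p l : Fin k → ℕ} (h : Λ.IsSegment μ p (p + l) ν) :
    Λ.d ν = l := by
  obtain ⟨_, _, _, _, _, _, h⟩ := h
  exact add_left_cancel h

theorem IsSegment.eq_of_comp_eq {μ ν α β : Λ.Path} {p q : Fin k → ℕ}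
    (h : Λ.IsSegment μ p q ν) (hα : Λ.d α = p) (hs : Λ.s α = Λ.r β) (hc : Λ.comp α β hs = μ) :
    ∃ (γ : Λ.Path) (e : Λ.s ν = Λ.r γ), Λ.comp ν γ e = β := by
  obtain ⟨α', γ, e, e', hc', hα', -⟩ := h
  exact ⟨γ, e, (comp_inj (hα'.trans hα.symm) (hc'.trans hc.symm)).2⟩

/-- In an aperiodic `k`-graph, an element of nonzero degree is annihilated by compression to a
suitable path. -/
theorem Aperiodic.exists_compression_eq_zero (hap : Λ.Aperiodic) {M N : Fin k → ℕ} (hMN : M ≠ N)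
    {z : Λ.KP R} (hz : z ∈ Λ.level R M N) (x : Λ.Vertex) :
    ∃ ξ : Λ.Path, Λ.r ξ = x ∧ Λ.sGhost R ξ * z * Λ.sPath R ξ = 0 := by
  obtain ⟨ξ, ν, τ, hr, hd, hν, hτ, hne⟩ := hap x M N hMN
  refine ⟨ξ, hr, ?_⟩
  refine Submodule.span_induction (p := fun z _ => Λ.sGhost R ξ * z * Λ.sPath R ξ = 0)
    ?_ ?_ ?_ ?_ hz
  · rintro _ ⟨⟨⟨α, β⟩, hα, hβ, -⟩, rfl⟩
    have hα : Λ.d α = M := hα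
    have hβ : Λ.d β = N := hβ
    have h1 : Λ.sGhost R ξ * (Λ.sPath R α * Λ.sGhost R β) * Λ.sPath R ξ =
        (Λ.sGhost R ξ * Λ.sPath R α) * (Λ.sGhost R β * Λ.sPath R ξ) := by
      simp only [mul_assoc]
    refine h1.trans ?_
    rcases sGhost_mul_sPath_of_ge (R := R) (μ := ξ) (ν := α)
      (hα ▸ le_sup_left.trans hd) with h2 | ⟨α', e, hα', h2⟩
    · rw [h2, zero_mul]
    rcases sGhost_mul_sPath_of_le (R := R) (μ := ξ) (ν := β)
      (hβ ▸ le_sup_right.trans hd) with h3 | ⟨β', e', hβ', h3⟩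
    · rw [h3, mul_zero]
    -- The path `ξ` factors as `α α'` and as `β β'`, so `α'` begins with the segment `ν` of `ξ` at
    -- `M` and `β'` with the segment `τ` at `N`. Thus `s_{α'^*} s_{β'}` contains `s_{ν^*} s_τ`,
    -- which is zero because `ν ≠ τ` have the same degree.
    obtain ⟨γ, e₁, rfl⟩ := hν.eq_of_comp_eq hα e hα'
    obtain ⟨δ, e₂, rfl⟩ := hτ.eq_of_comp_eq hβ e' hβ'
    rw [h2, h3, ← sGhost_mul_sGhost e₁, ← sPath_mul_sPath e₂, mul_assoc,
      ← mul_assoc (Λ.sGhost R ν), sGhost_mul_sPath_of_ne (hν.d_eq.trans hτ.d_eq.symm) hne,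
      zero_mul, mul_zero]
  · rw [mul_zero, zero_mul]
  · intro y z _ _ hy hz
    rw [mul_add, add_mul, hy, hz, add_zero]
  · intro a y _ hy
    rw [mul_smul_comm, smul_mul_assoc, hy, smul_zero]

theorem compression_mem_component (hfin : Λ.RowFinite) {n : Fin k → ℤ} {z : Λ.KP R}
    (hz : z ∈ Λ.component R n) (μ ν : Λ.Path) :
    Λ.sGhost R μ * z * Λ.sPath R ν ∈ Λ.component R (n - degDiff μ ν) := by
  have h := mul_mem_component hfin (mul_mem_component hfin (sGhost_mem_component μ) hz)
    (sPath_mem_component ν)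
  convert h using 2
  funext i
  simp only [degDiff, Pi.sub_apply, Pi.add_apply]
  ring

/-- Each compression by a suitable path `ξ` removes one summand. With `ξ` on both sides, the degrees
of the other summands do not change, and `a p_x` becomes `a p_{s(ξ)}` with the same `a`. -/
theorem exists_smul_p_mem_of_sum_mem {ι : Type*} (hfin : Λ.RowFinite) (hap : Λ.Aperiodic)
    (J : TwoSidedIdeal (Λ.KP R)) (a : R) (D : Finset ι) (f : ι → Λ.KP R) (x : Λ.Vertex)
    (hf : ∀ i ∈ D, ∃ n ≠ 0, f i ∈ Λ.component R n) (hJ : a • Λ.p R x + ∑ i ∈ D, f i ∈ J) :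
    ∃ y, a • Λ.p R y ∈ J := by
  classical
  induction D using Finset.induction_on generalizing f x with
  | empty =>
    rw [Finset.sum_empty, add_zero] at hJ
    exact ⟨x, hJ⟩
  | insert j D hj ih =>
    obtain ⟨n, hn, hfj⟩ := hf j (Finset.mem_insert_self j D)
    obtain ⟨M, N, hMN, hlev⟩ := exists_mem_level hfin hfj
    have hne : M ≠ N := by
      rintro rfl
      exact hn (funext fun i => (hMN i).symm.trans (sub_self _))
    obtain ⟨ξ, hr, hξ⟩ := hap.exists_compression_eq_zero hne hlev x
    refine ih (fun i => Λ.sGhost R ξ * f i * Λ.sPath R ξ) (Λ.s ξ) (fun i hi => ?_) ?_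
    · obtain ⟨m, hm, hfi⟩ := hf i (Finset.mem_insert_of_mem hi)
      refine ⟨m, hm, ?_⟩
      have h := compression_mem_component hfin hfi ξ ξ
      rwa [show degDiff ξ ξ = 0 from funext fun _ => sub_self _, sub_zero] at h
    · have h := TwoSidedIdeal.mul_mem_right _ _ (Λ.sPath R ξ)
        (TwoSidedIdeal.mul_mem_left _ (Λ.sGhost R ξ) _ hJ)
      rw [Finset.sum_insert hj, mul_add, add_mul, mul_add, add_mul, hξ, zero_add, Finset.mul_sum,
        Finset.sum_mul, mul_smul_comm, smul_mul_assoc, mul_assoc, ← hr, p_mul_sPath,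
        sGhost_mul_sPath_self] at h
      exact h

/-- The Cuntz-Krieger uniqueness theorem: in the aperiodic case every nonzero ideal contains a
nonzero multiple of a vertex idempotent. -/
theorem exists_smul_p_mem_of_aperiodic (hfin : Λ.RowFinite) (hap : Λ.Aperiodic)
    {J : TwoSidedIdeal (Λ.KP R)} {z : Λ.KP R} (hz : z ∈ J) (hz0 : z ≠ 0) :
    ∃ (a : R) (x : Λ.Vertex), a ≠ 0 ∧ a • Λ.p R x ∈ J := by
  classical
  obtain ⟨f, hf, rfl⟩ := exists_finsupp_components hfin z
  obtain ⟨n, hn⟩ := exists_proj_ne_zero hfin hz0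
  rw [proj_finsupp_sum hf] at hn
  -- Compressing by a pair of degree difference `n` turns the component of degree `n` into `a
  -- p_{s(μ)}` and moves that of degree `m` to degree `m - n`, which is nonzero for `m ≠ n`.
  obtain ⟨μ, ν, a, hd, ha, hc⟩ := exists_compression_of_ne_zero hfin (hf n) hn
  have h := TwoSidedIdeal.mul_mem_right _ _ (Λ.sPath R ν)
    (TwoSidedIdeal.mul_mem_left _ (Λ.sGhost R μ) _ hz)
  rw [Finsupp.sum, ← Finset.add_sum_erase _ _ (Finsupp.mem_support_iff.2 hn), mul_add, add_mul, hc,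
    Finset.mul_sum, Finset.sum_mul] at h
  obtain ⟨x, hx⟩ := exists_smul_p_mem_of_sum_mem hfin hap J a _ _ _
    (fun m hm => ⟨m - n, sub_ne_zero.2 (Finset.ne_of_mem_erase hm),
      hd ▸ compression_mem_component hfin (hf m) μ ν⟩) h
  exact ⟨a, x, ha, hx⟩

/-- The graded uniqueness theorem: a nonzero ideal which contains the homogeneous components of its
elements contains a nonzero multiple of a vertex idempotent. -/
theorem exists_smul_p_mem_of_isGraded (hfin : Λ.RowFinite) {J : TwoSidedIdeal (Λ.KP R)}
    (hJ : IsGraded J) {z : Λ.KP R} (hz : z ∈ J) (hz0 : z ≠ 0) :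
    ∃ (a : R) (x : Λ.Vertex), a ≠ 0 ∧ a • Λ.p R x ∈ J := by
  obtain ⟨n, hn⟩ := exists_proj_ne_zero hfin hz0
  obtain ⟨μ, ν, a, -, ha, hc⟩ :=
    exists_compression_of_ne_zero hfin (proj_mem_component hfin n z) hn
  refine ⟨a, Λ.s μ, ha, ?_⟩
  rw [← hc]
  exact TwoSidedIdeal.mul_mem_right _ _ _
    (TwoSidedIdeal.mul_mem_left _ _ _ ((isGraded_iff hfin).1 hJ z hz n))

end Uniqueness

/-! ### The isomorphism of `KP_R(Λ ∖ H_I)` with `KP_R(Λ)/I` -/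

section Quotient

variable {k : ℕ} {Λ : KGraph.{u, v} k} {R : Type w} [CommRing R]

theorem rowFinite_minus (hfin : Λ.RowFinite) (H : Set Λ.Vertex) (hH : Λ.IsHereditary H) :
    (Λ.minus H hH).RowFinite := fun x n =>
  ((hfin x.1 n).preimage (f := Subtype.val) Subtype.val_injective.injOn).subset
    fun _ hμ => ⟨congrArg Subtype.val hμ.1, hμ.2⟩

theorem toQuot_surjective (I : TwoSidedIdeal (Λ.KP R)) : Function.Surjective (toQuot I) :=
  Quotient.mk''_surjective

instance (I : TwoSidedIdeal (Λ.KP R)) : IsScalarTower R (QuotKP I) (QuotKP I) where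
  smul_assoc a x y := by
    obtain ⟨x, rfl⟩ := toQuot_surjective I x
    obtain ⟨y, rfl⟩ := toQuot_surjective I y
    exact congrArg (toQuot I) (smul_mul_assoc a x y)

instance (I : TwoSidedIdeal (Λ.KP R)) : SMulCommClass R (QuotKP I) (QuotKP I) where
  smul_comm a x y := by
    obtain ⟨x, rfl⟩ := toQuot_surjective I x
    obtain ⟨y, rfl⟩ := toQuot_surjective I y
    exact congrArg (toQuot I) (mul_smul_comm a x y).symm

/-- The quotient map as a homomorphism of algebras. -/
noncomputable def quotHom (I : TwoSidedIdeal (Λ.KP R)) : Λ.KP R →ₙₐ[R] QuotKP I where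
  toFun := toQuot I
  map_smul' _ _ := rfl
  map_zero' := rfl
  map_add' _ _ := rfl
  map_mul' _ _ := rfl

theorem quotHom_eq_zero_iff {I : TwoSidedIdeal (Λ.KP R)} {z : Λ.KP R} :
    quotHom I z = 0 ↔ z ∈ I := by
  rw [TwoSidedIdeal.mem_iff]
  exact I.ringCon.eq

/-- The images in `KP_R(Λ)` of the generators of `KP_R(Λ ∖ H_I)`. -/
noncomputable def quotientGraphGen (I : TwoSidedIdeal (Λ.KP R)) :
    (quotientGraph I).Gen → Λ.KP R
  | .vertex x => Λ.p R x.1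
  | .path μ _ => Λ.sPath R μ.1
  | .ghost μ _ => Λ.sGhost R μ.1

/-- (KP4) for `Λ ∖ H_I` modulo `I`: the terms of (KP4) for `Λ` that are missing belong to paths with
source in `H_I`, hence lie in `I`. -/
theorem p_sub_sum_mem (hfin : Λ.RowFinite) (I : TwoSidedIdeal (Λ.KP R)) (x : Λ.Vertex)
    (n : Fin k → ℕ) (T : Finset {μ : Λ.Path // Λ.s μ ∉ vertexSet I})
    (hT : ∀ μ, μ ∈ T ↔ μ.1 ∈ Λ.pathsAt x n) :
    Λ.p R x - ∑ μ ∈ T, Λ.sPath R μ.1 * Λ.sGhost R μ.1 ∈ I := by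
  classical
  have h1 : T.map ⟨Subtype.val, Subtype.val_injective⟩ ⊆ (hfin x n).toFinset := by
    intro μ hμ
    obtain ⟨ν, hν, rfl⟩ := Finset.mem_map.1 hμ
    exact (hfin x n).mem_toFinset.2 ((hT ν).1 hν)
  have h2 : ∑ μ ∈ T, Λ.sPath R μ.1 * Λ.sGhost R μ.1 =
      ∑ μ ∈ T.map ⟨Subtype.val, Subtype.val_injective⟩, Λ.sPath R μ * Λ.sGhost R μ := by
    rw [Finset.sum_map, Function.Embedding.coeFn_mk]
  rw [h2, p_eq_sum hfin x n, ← Finset.sum_sdiff h1, add_sub_cancel_right]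
  refine sum_mem fun μ hμ => sPath_mul_sGhost_mem ?_ μ
  obtain ⟨h3, h4⟩ := Finset.mem_sdiff.1 hμ
  by_contra h5
  exact h4 (Finset.mem_map.2 ⟨⟨μ, h5⟩, (hT _).2 ((hfin x n).mem_toFinset.1 h3), rfl⟩)

/-- All relations except (KP4) hold already for the representatives in `KP_R(Λ)`. -/
theorem freeLift_quotientGraphGen (hfin : Λ.RowFinite) (I : TwoSidedIdeal (Λ.KP R))
    (y : (quotientGraph I).FreeAlg R) (hy : Rel (quotientGraph I) R y) :
    freeLift (fun g => quotHom I (quotientGraphGen I g)) y = 0 := by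
  cases hy with
  | idem x =>
    rw [map_sub, map_mul, freeLift_gen, ← map_mul, sub_eq_zero]
    exact congrArg _ (p_mul_p_self x.1)
  | orthogonal x y hxy =>
    rw [map_mul, freeLift_gen, freeLift_gen, ← map_mul]
    exact congrArg _ (p_mul_p_of_ne fun h => hxy (Subtype.ext h))
  | path_mul μ ν hμ hν h hμν =>
    rw [map_sub, map_mul, freeLift_gen, freeLift_gen, freeLift_gen, ← map_mul, sub_eq_zero]
    exact congrArg _ (sPath_mul_sPath (congrArg Subtype.val h))
  | ghost_mul μ ν hμ hν h hμν =>
    rw [map_sub, map_mul, freeLift_gen, freeLift_gen, freeLift_gen, ← map_mul, sub_eq_zero]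
    exact congrArg _ (sGhost_mul_sGhost (congrArg Subtype.val h))
  | range_path μ hμ =>
    rw [map_sub, map_mul, freeLift_gen, freeLift_gen, ← map_mul, sub_eq_zero]
    exact congrArg _ (p_mul_sPath μ.1)
  | path_source μ hμ =>
    rw [map_sub, map_mul, freeLift_gen, freeLift_gen, ← map_mul, sub_eq_zero]
    exact congrArg _ (sPath_mul_p μ.1)
  | source_ghost μ hμ =>
    rw [map_sub, map_mul, freeLift_gen, freeLift_gen, ← map_mul, sub_eq_zero]
    exact congrArg _ (p_mul_sGhost μ.1)
  | ghost_range μ hμ =>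
    rw [map_sub, map_mul, freeLift_gen, freeLift_gen, ← map_mul, sub_eq_zero]
    exact congrArg _ (sGhost_mul_p μ.1)
  | ghost_path_self μ hμ =>
    rw [map_sub, map_mul, freeLift_gen, freeLift_gen, freeLift_gen, ← map_mul, sub_eq_zero]
    exact congrArg _ (sGhost_mul_sPath_self μ.1)
  | ghost_path_of_ne μ ν hμ hν hd hμν =>
    rw [map_mul, freeLift_gen, freeLift_gen, ← map_mul]
    exact congrArg _ (sGhost_mul_sPath_of_ne hd fun h => hμν (Subtype.ext h))
  | sum_path_ghost x n hn hfin' =>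
    rw [map_sub, map_sum]
    simp only [map_mul, freeLift_gen]
    simp only [← map_mul]
    rw [← map_sum, ← map_sub, quotHom_eq_zero_iff]
    have h := p_sub_sum_mem hfin I x.1 n hfin'.toFinset fun μ =>
      hfin'.mem_toFinset.trans (and_congr Subtype.ext_iff Iff.rfl)
    have e := Finset.sum_attach hfin'.toFinset
      fun μ : (quotientGraph I).Path => Λ.sPath R μ.1 * Λ.sGhost R μ.1
    exact (congrArg (fun t => Λ.p R x.1 - t ∈ I) e).mpr h

/-- The canonical homomorphism `KP_R(Λ ∖ H_I) → KP_R(Λ)/I`. -/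
noncomputable def fromQuotientGraph (hfin : Λ.RowFinite) (I : TwoSidedIdeal (Λ.KP R)) :
    (quotientGraph I).KP R →ₙₐ[R] QuotKP I :=
  lift (fun g => quotHom I (quotientGraphGen I g)) (freeLift_quotientGraphGen hfin I)

theorem fromQuotientGraph_p (hfin : Λ.RowFinite) (I : TwoSidedIdeal (Λ.KP R))
    (x : (quotientGraph I).Vertex) :
    fromQuotientGraph hfin I ((quotientGraph I).p R x) = quotHom I (Λ.p R x.1) :=
  lift_gen _ _ _

theorem fromQuotientGraph_sPath (hfin : Λ.RowFinite) (I : TwoSidedIdeal (Λ.KP R))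
    (μ : (quotientGraph I).Path) :
    fromQuotientGraph hfin I ((quotientGraph I).sPath R μ) = quotHom I (Λ.sPath R μ.1) := by
  by_cases h : (quotientGraph I).d μ = 0
  · rw [sPath_of_d_eq_zero h, fromQuotientGraph_p, sPath_of_d_eq_zero (Λ := Λ) h]
    rfl
  · rw [sPath_of_d_ne_zero h]
    exact lift_gen _ _ _

theorem fromQuotientGraph_sGhost (hfin : Λ.RowFinite) (I : TwoSidedIdeal (Λ.KP R))
    (μ : (quotientGraph I).Path) :
    fromQuotientGraph hfin I ((quotientGraph I).sGhost R μ) = quotHom I (Λ.sGhost R μ.1) := by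
  by_cases h : (quotientGraph I).d μ = 0
  · rw [sGhost_of_d_eq_zero h, fromQuotientGraph_p, sGhost_of_d_eq_zero (Λ := Λ) h]
    rfl
  · rw [sGhost_of_d_ne_zero h]
    exact lift_gen _ _ _

/-- Generators without a counterpart in `Λ ∖ H_I` have a factor `p_x` with `x ∈ H_I`, so they vanish
modulo `I`. -/
theorem exists_fromQuotientGraph_gen (hfin : Λ.RowFinite) (I : TwoSidedIdeal (Λ.KP R))
    (g : Λ.Gen) : ∃ y, fromQuotientGraph hfin I y = quotHom I (Λ.toKP R (Λ.gen R g)) := by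
  cases g with
  | vertex x =>
    by_cases hx : Λ.p R x ∈ I
    · exact ⟨0, (map_zero _).trans (quotHom_eq_zero_iff.2 hx).symm⟩
    · exact ⟨_, fromQuotientGraph_p hfin I ⟨x, hx⟩⟩
  | path μ h =>
    rw [← sPath_of_d_ne_zero h]
    by_cases hx : Λ.p R (Λ.s μ) ∈ I
    · refine ⟨0, (map_zero _).trans (quotHom_eq_zero_iff.2 ?_).symm⟩
      rw [← sPath_mul_p]
      exact TwoSidedIdeal.mul_mem_left _ _ _ hx
    · exact ⟨_, fromQuotientGraph_sPath hfin I ⟨μ, hx⟩⟩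
  | ghost μ h =>
    rw [← sGhost_of_d_ne_zero h]
    by_cases hx : Λ.p R (Λ.s μ) ∈ I
    · refine ⟨0, (map_zero _).trans (quotHom_eq_zero_iff.2 ?_).symm⟩
      rw [← p_mul_sGhost]
      exact TwoSidedIdeal.mul_mem_right _ _ _ hx
    · exact ⟨_, fromQuotientGraph_sGhost hfin I ⟨μ, hx⟩⟩

theorem fromQuotientGraph_surjective (hfin : Λ.RowFinite) (I : TwoSidedIdeal (Λ.KP R)) :
    Function.Surjective (fromQuotientGraph hfin I) := by
  intro z
  obtain ⟨z, rfl⟩ := toQuot_surjective I z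
  obtain ⟨z, rfl⟩ := Λ.toKP_surjective R z
  change ∃ y, fromQuotientGraph hfin I y = quotHom I (Λ.toKP R z)
  induction z using MonoidAlgebra.induction_linear with
  | zero => exact ⟨0, (map_zero _).trans (map_zero (quotHom I)).symm⟩
  | add x y hx hy =>
    obtain ⟨x', hx⟩ := hx
    obtain ⟨y', hy⟩ := hy
    exact ⟨x' + y', by rw [map_add, hx, hy, toKP_add, map_add]⟩
  | single w a =>
    rw [single_eq_smul, toKP_smul, map_smul]
    suffices h : ∃ y, fromQuotientGraph hfin I y =
        quotHom I (Λ.toKP R (MonoidAlgebra.single w 1)) by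
      obtain ⟨y, hy⟩ := h
      exact ⟨a • y, by rw [map_smul, hy]⟩
    induction w using FreeSemigroup.recOnMul with
    | ih1 g => exact exists_fromQuotientGraph_gen hfin I g
    | ih2 g w _ hw =>
      obtain ⟨x, hx⟩ := exists_fromQuotientGraph_gen hfin I g
      obtain ⟨y, hy⟩ := hw
      exact ⟨x * y, by rw [map_mul, hx, hy, single_of_mul, toKP_mul, map_mul]⟩

/-- The kernel of `KP_R(Λ ∖ H_I) → KP_R(Λ)/I`. -/
noncomputable def kerFromQuotientGraph (hfin : Λ.RowFinite) (I : TwoSidedIdeal (Λ.KP R)) :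
    TwoSidedIdeal ((quotientGraph I).KP R) :=
  TwoSidedIdeal.ker (fromQuotientGraph hfin I)

theorem mem_kerFromQuotientGraph {hfin : Λ.RowFinite} {I : TwoSidedIdeal (Λ.KP R)}
    {y : (quotientGraph I).KP R} :
    y ∈ kerFromQuotientGraph hfin I ↔ fromQuotientGraph hfin I y = 0 :=
  TwoSidedIdeal.mem_ker _

/-- The canonical homomorphism `KP_R(Λ ∖ H_I) → KP_R(Λ)/I` is compatible with the gradings. -/
theorem exists_lift_component (hfin : Λ.RowFinite) (I : TwoSidedIdeal (Λ.KP R)) {n : Fin k → ℤ}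
    {y : (quotientGraph I).KP R} (hy : y ∈ (quotientGraph I).component R n) :
    ∃ x ∈ Λ.component R n, quotHom I x = fromQuotientGraph hfin I y := by
  refine Submodule.span_induction ?_ ?_ ?_ ?_ hy
  · rintro _ ⟨μ, ν, h, rfl⟩
    refine ⟨_, Submodule.subset_span ⟨μ.1, ν.1, h, rfl⟩, ?_⟩
    rw [map_mul, map_mul, fromQuotientGraph_sPath, fromQuotientGraph_sGhost]
  · exact ⟨0, Submodule.zero_mem _, (map_zero _).trans (map_zero _).symm⟩
  · rintro x y _ _ ⟨x', h, hx⟩ ⟨y', h', hy⟩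
    exact ⟨x' + y', Submodule.add_mem _ h h', by rw [map_add, map_add, hx, hy]⟩
  · rintro a x _ ⟨x', h, hx⟩
    exact ⟨a • x', Submodule.smul_mem _ a h, by rw [map_smul, map_smul, hx]⟩

/-- Lift the components of `y` to `KP_R(Λ)`, keeping degrees. The sum of the lifts lies in `I`, so
each lift does, because `I` is graded. -/
theorem isGraded_kerFromQuotientGraph (hfin : Λ.RowFinite) {I : TwoSidedIdeal (Λ.KP R)}
    (hI : IsGraded I) : IsGraded (kerFromQuotientGraph hfin I) := by
  have hfin' : (quotientGraph I).RowFinite := rowFinite_minus hfin _ _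
  rw [isGraded_iff hfin']
  intro y hy n
  obtain ⟨f, hf, rfl⟩ := exists_finsupp_components hfin' y
  rw [proj_finsupp_sum hf]
  rw [mem_kerFromQuotientGraph, Finsupp.sum, map_sum] at hy
  rw [mem_kerFromQuotientGraph]
  choose g hg hg' using fun m => exists_lift_component hfin I (hf m)
  simp only [← hg'] at hy ⊢
  rw [← map_sum, quotHom_eq_zero_iff] at hy
  rw [quotHom_eq_zero_iff]
  have h := (isGraded_iff hfin).1 hI _ hy n
  classical
  rw [map_sum] at h
  simp only [proj_of_mem_component (hg _) n] at h
  rw [Finset.sum_ite_eq' f.support n g] at h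
  split_ifs at h with hn
  · exact h
  -- Outside the support of `f` the chosen lift `g n` need not be zero, but it has the same image as
  -- `f n = 0`.
  · rw [← quotHom_eq_zero_iff, hg', Finsupp.notMem_support_iff.1 hn, map_zero]

/-- A nonzero kernel would contain some `a p_x` with `a ≠ 0`; then `a p_x ∈ I` in `KP_R(Λ)`, and
basicness contradicts `x ∉ H_I`. -/
theorem fromQuotientGraph_injective (hfin : Λ.RowFinite) {I : TwoSidedIdeal (Λ.KP R)}
    (hb : IsBasic I) (h : IsGraded I ∨ (quotientGraph I).Aperiodic) :
    Function.Injective (fromQuotientGraph hfin I) := by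
  have hfin' : (quotientGraph I).RowFinite := rowFinite_minus hfin _ _
  rw [injective_iff_map_eq_zero]
  intro y hy
  by_contra hy0
  have hy : y ∈ kerFromQuotientGraph hfin I := mem_kerFromQuotientGraph.2 hy
  obtain ⟨a, x, ha, hx⟩ : ∃ (a : R) (x : (quotientGraph I).Vertex), a ≠ 0 ∧
      a • (quotientGraph I).p R x ∈ kerFromQuotientGraph hfin I := by
    rcases h with h | h
    · exact exists_smul_p_mem_of_isGraded hfin' (isGraded_kerFromQuotientGraph hfin h) hy hy0
    · exact exists_smul_p_mem_of_aperiodic hfin' h hy hy0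
  rw [mem_kerFromQuotientGraph, map_smul, fromQuotientGraph_p, ← map_smul,
    quotHom_eq_zero_iff] at hx
  exact x.2 (hb a x.1 ha hx)

end Quotient

/-! ### The lattice isomorphism -/

section Lattice

variable {k : ℕ} {Λ : KGraph.{u, v} k} {R : Type w} [CommRing R]

/-- The vertex set of an ideal as a saturated hereditary set. -/
def satHerOf (hfin : Λ.RowFinite) (I : TwoSidedIdeal (Λ.KP R)) : Λ.SatHer :=
  ⟨vertexSet I, isHereditary_vertexSet I, isSaturated_vertexSet hfin I⟩

theorem idealOf_le_iff_le_satHerOf (hfin : Λ.RowFinite) {H : Λ.SatHer}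
    {I : TwoSidedIdeal (Λ.KP R)} : idealOf R H.1 ≤ I ↔ H ≤ satHerOf hfin I :=
  idealOf_le_iff

theorem idealOf_mono {H K : Λ.SatHer} (h : H ≤ K) : idealOf R H.1 ≤ idealOf R K.1 :=
  TwoSidedIdeal.span_mono (Set.image_mono h)

theorem satHerOf_idealOf [Nontrivial R] (hfin : Λ.RowFinite) (H : Λ.SatHer) :
    satHerOf hfin (idealOf R H.1) = H :=
  Subtype.ext (vertexSet_idealOf H.2.1 H.2.2)

theorem idealOf_satHerOf (hfin : Λ.RowFinite) {I : TwoSidedIdeal (Λ.KP R)} (hb : IsBasic I)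
    (hg : IsGraded I) : idealOf R (satHerOf hfin I).1 = I :=
  idealOf_vertexSet hfin hb hg

theorem satHerOf_mono (hfin : Λ.RowFinite) {I J : TwoSidedIdeal (Λ.KP R)} (h : I ≤ J) :
    satHerOf hfin I ≤ satHerOf hfin J :=
  fun _ hx => h hx

variable (R) in
/-- Saturated hereditary sets correspond to basic graded ideals. -/
noncomputable def satHerOrderIso [Nontrivial R] (hfin : Λ.RowFinite) :
    Λ.SatHer ≃o {I : TwoSidedIdeal (Λ.KP R) // IsBasic I ∧ IsGraded I} where
  toFun H := ⟨idealOf R H.1, isBasic_idealOf H.2.1 H.2.2, isGraded_idealOf hfin H.1⟩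
  invFun I := satHerOf hfin I.1
  left_inv H := satHerOf_idealOf hfin H
  right_inv I := Subtype.ext (idealOf_satHerOf hfin I.2.1 I.2.2)
  map_rel_iff' {H K} := (idealOf_le_iff_le_satHerOf hfin).trans
    (iff_of_eq (congrArg (H ≤ ·) (satHerOf_idealOf hfin K)))

/-- The intersection of two basic graded ideals is again basic and graded, hence generated by its
vertex idempotents, and its vertices lie in both `H` and `K`. -/
theorem idealOf_inf [Nontrivial R] (hfin : Λ.RowFinite) (H K : Λ.SatHer) :
    idealOf R (H ⊓ K).1 = idealOf R H.1 ⊓ idealOf R K.1 := by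
  refine le_antisymm (le_inf (idealOf_mono inf_le_left) (idealOf_mono inf_le_right)) ?_
  have hb : IsBasic (idealOf R H.1 ⊓ idealOf R K.1) := fun a x ha hx => by
    rw [TwoSidedIdeal.mem_inf] at hx ⊢
    exact ⟨isBasic_idealOf H.2.1 H.2.2 a x ha hx.1, isBasic_idealOf K.2.1 K.2.2 a x ha hx.2⟩
  have hg : IsGraded (idealOf R H.1 ⊓ idealOf R K.1) := by
    rw [isGraded_iff hfin]
    intro x hx n
    rw [TwoSidedIdeal.mem_inf] at hx ⊢
    exact ⟨(isGraded_iff hfin).1 (isGraded_idealOf hfin H.1) x hx.1 n,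
      (isGraded_iff hfin).1 (isGraded_idealOf hfin K.1) x hx.2 n⟩
  rw [← idealOf_satHerOf hfin hb hg]
  refine idealOf_mono (le_inf ?_ ?_)
  · exact (satHerOf_mono hfin inf_le_left).trans_eq (satHerOf_idealOf hfin H)
  · exact (satHerOf_mono hfin inf_le_right).trans_eq (satHerOf_idealOf hfin K)

/-- `H ↦ I_H` is left adjoint to `I ↦ H_I`, so it preserves joins. The adjunction holds for
arbitrary ideals, because `H_I` is always saturated and hereditary; the sum need not be known to be
basic or graded beforehand. -/
theorem idealOf_sup (hfin : Λ.RowFinite) (H K : Λ.SatHer) :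
    idealOf R (H ⊔ K).1 = idealOf R H.1 ⊔ idealOf R K.1 := by
  refine le_antisymm ?_ (sup_le (idealOf_mono le_sup_left) (idealOf_mono le_sup_right))
  rw [idealOf_le_iff_le_satHerOf hfin]
  exact sup_le ((idealOf_le_iff_le_satHerOf hfin).1 le_sup_left)
    ((idealOf_le_iff_le_satHerOf hfin).1 le_sup_right)

end Lattice

end KGraph

theorem theorem5p1 {k : ℕ} (hk : 0 < k) (Λ : KGraph.{u, v} k)
    (hfin : Λ.RowFinite) (hsrc : Λ.NoSources)
    (R : Type w) [CommRing R] [Nontrivial R] :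
    -- `H ↦ I_H` is an isomorphism of ordered sets onto the basic graded ideals
    (∃ e : Λ.SatHer ≃o {I : TwoSidedIdeal (Λ.KP R) // KGraph.IsBasic I ∧ KGraph.IsGraded I},
      ∀ H : Λ.SatHer, (e H : TwoSidedIdeal (Λ.KP R)) = KGraph.idealOf R H.1) ∧
    -- it carries meets and joins to meets (intersections) and joins (sums) of ideals
    (∀ H K : Λ.SatHer,
      KGraph.idealOf R (H ⊓ K).1 = KGraph.idealOf R H.1 ⊓ KGraph.idealOf R K.1 ∧
      KGraph.idealOf R (H ⊔ K).1 = KGraph.idealOf R H.1 ⊔ KGraph.idealOf R K.1) ∧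
    -- `KP_R(Λ ∖ H_I) ≅ KP_R(Λ)/I` as `R`-algebras, matching the generators
    (∀ I : TwoSidedIdeal (Λ.KP R), KGraph.IsBasic I →
      (KGraph.IsGraded I ∨ (KGraph.quotientGraph I).Aperiodic) →
      ∃ π : (KGraph.quotientGraph I).KP R →ₙₐ[R] KGraph.QuotKP I,
        Function.Bijective π ∧
        (∀ x : (KGraph.quotientGraph I).Vertex,
          π ((KGraph.quotientGraph I).p R x) = KGraph.toQuot I (Λ.p R x.1)) ∧
        (∀ μ : (KGraph.quotientGraph I).Path,
          π ((KGraph.quotientGraph I).sPath R μ) = KGraph.toQuot I (Λ.sPath R μ.1) ∧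
          π ((KGraph.quotientGraph I).sGhost R μ) = KGraph.toQuot I (Λ.sGhost R μ.1))) := by
  refine ⟨⟨KGraph.satHerOrderIso R hfin, fun _ => rfl⟩,
    fun H K => ⟨KGraph.idealOf_inf hfin H K, KGraph.idealOf_sup hfin H K⟩, fun I hb h => ?_⟩
  exact ⟨KGraph.fromQuotientGraph hfin I,
    ⟨KGraph.fromQuotientGraph_injective hfin hb h, KGraph.fromQuotientGraph_surjective hfin I⟩,
    KGraph.fromQuotientGraph_p hfin I,
    fun μ => ⟨KGraph.fromQuotientGraph_sPath hfin I μ, KGraph.fromQuotientGraph_sGhost hfin I μ⟩⟩
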